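/- Let $n\ge 1$ be an integer, let $\sigma_x^2,\sigma_w^2>0$, and put $\Omega=\sigma_x^2/\sigma_w^2$, $\sigma_y^2=\sigma_x^2+\sigma_w^2$. Let $x\in\mathbb R^n$ satisfy $\|x\|^2=n\sigma_x^2$. Let $p(\cdot\,|x)$ be the density of $\mathcal N(x,\sigma_w^2 I_n)$ and $q$ the density of $\mathcal N(0,\sigma_y^2 I_n)$, and let $\Lambda(x,y)=\frac1n\ln\frac{p(y|x)}{q(y)}$. For a threshold $\lambda$ the missed-detection and false-alarm probabilities of the Neyman–Pearson test for the AWGN channel are $$P_{MD}=\mathrm P[\Lambda(x,y)<\lambda \mid y\sim\mathcal N(x,\sigma_w^2I_n)],\qquad P_{FA}=\mathrm P[\Lambda(x,y)\ge\lambda \mid y\sim\mathcal N(0,\sigma_y^2I_n)].$$ Let $F_\chi(a;n,s)$ and $\overline F_\chi(a;n,s)$ be the CDF and CCDF of the non-central $\chi^2$ distribution of order $n$ and parameter $s$ (the law of $\|Z\|^2$ for $Z\sim\mathcal N(m,I_n)$, $\|m\|^2=s$). Let $\gamma>0$, $s_\gamma=\sinh\gamma$, $c_\gamma=\cosh\gamma$,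 let $\lambda'=\Omega/(4s_\gamma^2)$, and let $\lambda$ be given by $2\lambda=1+\ln(1+\Omega)-\frac{\Omega}{1+\Omega}\lambda'$. Define $$\theta_{MD}=\ln\frac{\Omega}{2s_\gamma},\qquad \theta_{FA}=\ln\frac{\Omega}{2s_\gamma}-\ln(1+\Omega),\qquad \alpha(z)=c_\gamma-\cosh z+s_\gamma(z-\gamma).$$ For every real $u\ne0$ the equation $\mathrm{sign}(\Im z)\sqrt{2\alpha(\ln z)}=u$ (principal logarithm and square root) has exactly one solution $z=t(u)\in\mathbb C$, and $t$ is differentiable at every real $u\neq 0$. For $\theta\in\{\theta_{MD},\theta_{FA}\}$ put $$s=\mathrm{sign}(\gamma-\theta),\quad v=-\frac{\alpha(\theta)}{s_\gamma},\quad f(u)=\frac{t'(u)}{e^{\theta}-t(u)},\quad g=\frac1\pi\int_0^\infty \Im[f(u)]\,e^{-nu^2/(4s_\gamma)}\,du,$$ and denote the resulting quantities by $s_{MD},v_{MD},g_{MD}$ and $s_{FA},v_{FA},g_{FA}$ respectively. Let $1(\xi)=1$ for $\xi\ge0$ and $1(\xi)=0$ for $\xi<0$. Then $$P_{MD}=\overline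 F_\chi\Big(n\lambda';n,\frac n\Omega\Big),\qquad P_{FA}=F_\chi\Big(\frac{n\lambda'}{1+\Omega};n,n\frac{1+\Omega}{\Omega}\Big).$$ If $\gamma\ne\theta_{MD}$, the integral defining $g_{MD}$ converges absolutely and $$P_{MD}=1(s_{MD})+g_{MD}\,e^{-\frac12 n v_{MD}}.$$ If $\gamma\ne\theta_{FA}$, the integral defining $g_{FA}$ converges absolutely and $$P_{FA}=1(-s_{FA})-g_{FA}\,e^{-\frac12 n v_{FA}}.$$ -/

import Mathlib

open MeasureTheory ProbabilityTheory Set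
open scoped NNReal ENNReal

noncomputable section

namespace AWGN

/-! ### The channel and the Neyman-Pearson test

Real `n`-vectors are functions `Fin n → ℝ`. Variances are nonnegative reals: `vx` is the power per
symbol `σ_x²`, `vw` is the noise variance `σ_w²`. -/

/-- The constant energy set `{x | ‖x‖² = n σ_x²}` (Euclidean norm). -/
def constEnergy (n : ℕ) (vx : ℝ≥0) : Set (Fin n → ℝ) :=
  {x | ∑ i, x i ^ 2 = n * (vx : ℝ)}

/-- The signal to noise ratio `Ω = σ_x² / σ_w²`. -/
def snr (vx vw : ℝ≥0) : ℝ := (vx : ℝ) / (vw : ℝ)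

/-- The density at `b` of a Gaussian vector with mean `a` and covariance `v I`. -/
def gaussDensity {n : ℕ} (a : Fin n → ℝ) (v : ℝ≥0) (b : Fin n → ℝ) : ℝ :=
  ∏ i, gaussianPDFReal (a i) v (b i)

/-- The law of a Gaussian vector with mean `a` and covariance `v I`. -/
def gaussLaw {n : ℕ} (a : Fin n → ℝ) (v : ℝ≥0) : Measure (Fin n → ℝ) :=
  Measure.pi fun i => gaussianReal (a i) v

/-- The normalized log-likelihood ratio `Λ(x, y) = (1/n) ln (p(y|x) / q(y))`, where `p(·|x)` is the
channel density `N(x, σ_w² I)` and `q` is the density of `N(0, σ_y² I)`, `σ_y² = σ_x² + σ_w²`. -/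
def logLik {n : ℕ} (vx vw : ℝ≥0) (x y : Fin n → ℝ) : ℝ :=
  1 / (n : ℝ) * Real.log (gaussDensity x vw y / gaussDensity 0 (vx + vw) y)

/-- Missed detection probability: the probability of `Λ(x, y) < λ` when `y ∼ N(x, σ_w² I)`. -/
def probMD {n : ℕ} (vx vw : ℝ≥0) (x : Fin n → ℝ) (lam : ℝ) : ℝ :=
  (gaussLaw x vw).real {y | logLik vx vw x y < lam}

/-- False alarm probability: the probability of `Λ(x, y) ≥ λ` when `y ∼ N(0, σ_y² I)`. -/
def probFA {n : ℕ} (vx vw : ℝ≥0) (x : Fin n → ℝ) (lam : ℝ) : ℝ :=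
  (gaussLaw (0 : Fin n → ℝ) (vx + vw)).real {y | lam ≤ logLik vx vw x y}

/-! ### The non-central chi-squared distribution -/

/-- The non-central chi-squared distribution of order `n ≥ 1` and parameter `s ≥ 0`: the law of
`‖Z‖²` for `Z ∼ N(m, I)` in dimension `n` with `‖m‖² = s`. The law depends on `m` only through
`‖m‖²`; here `m` has all its coordinates equal. -/
def chiSq (n : ℕ) (s : ℝ) : Measure ℝ :=
  (gaussLaw (fun _ : Fin n => Real.sqrt (s / n)) 1).map fun z => ∑ i, z i ^ 2

/-- The distribution function of the non-central chi-squared distribution. -/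
def chiSqCDF (a : ℝ) (n : ℕ) (s : ℝ) : ℝ := (chiSq n s).real (Iic a)

/-- The complementary distribution function of the non-central chi-squared distribution. -/
def chiSqCCDF (a : ℝ) (n : ℕ) (s : ℝ) : ℝ := (chiSq n s).real (Ioi a)

/-! ### The functions in the integral representation -/

/-- The unit step: `1` for `x ≥ 0` and `0` otherwise. -/
def unitStep (x : ℝ) : ℝ := if 0 ≤ x then 1 else 0

/-- `θ(γ)` in the missed detection case. -/
def thetaMD (Ω γ : ℝ) : ℝ := Real.log (Ω / (2 * Real.sinh γ))

/-- `θ(γ)` in the false alarm case. -/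
def thetaFA (Ω γ : ℝ) : ℝ := Real.log (Ω / (2 * Real.sinh γ)) - Real.log (1 + Ω)

/-- `s(γ)` as a function of `γ` and `θ = θ(γ)`. -/
def sgn (γ θ : ℝ) : ℝ := Real.sign (γ - θ)

/-- The function `α` on the real line. -/
def alpha (γ x : ℝ) : ℝ := Real.cosh γ - Real.cosh x + Real.sinh γ * (x - γ)

/-- The function `α` on the complex plane. -/
def alphaC (γ : ℝ) (z : ℂ) : ℂ :=
  Complex.cosh γ - Complex.cosh z + Complex.sinh γ * (z - γ)

theorem alphaC_ofReal (γ x : ℝ) : alphaC γ (x : ℂ) = (alpha γ x : ℂ) := by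
  simp [alphaC, alpha]

/-- `v(γ)` as a function of `γ` and `θ = θ(γ)`. -/
def vfun (γ θ : ℝ) : ℝ := -alpha γ θ / Real.sinh γ

/-- The map `z ↦ sign(Im z) √(2 α(ln z))`, with principal logarithm and square root. -/
def tInv (γ : ℝ) (z : ℂ) : ℂ :=
  (Real.sign z.im : ℂ) * Complex.sqrt (2 * alphaC γ (Complex.log z))

/-- The function `t` of a real variable, inverse to `tInv`. For `u ≠ 0` it picks the solution `z`
of `tInv γ z = u`. Every real `z` solves this for `u = 0`, and there `t` takes the value `e^γ`
which makes it continuous. -/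
def tfun (γ u : ℝ) : ℂ :=
  if u = 0 then (Real.exp γ : ℂ) else Function.invFun (tInv γ) (u : ℂ)

/-- `f(u) = t'(u) / (e^θ - t(u))`. -/
def ffun (γ θ u : ℝ) : ℂ := deriv (tfun γ) u / ((Real.exp θ : ℂ) - tfun γ u)

/-- The integrand of `g`, without the factor `1 / π`. -/
def gIntegrand (n : ℕ) (γ θ u : ℝ) : ℝ :=
  (ffun γ θ u).im * Real.exp (-(n * u ^ 2) / (4 * Real.sinh γ))

/-- `g(γ)` as a function of `n`, `γ` and `θ = θ(γ)`. -/
def gfun (n : ℕ) (γ θ : ℝ) : ℝ := 1 / Real.pi * ∫ u in Ioi (0 : ℝ), gIntegrand n γ θ u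

end AWGN

end

/-!
The two error probabilities are non-central chi-squared probabilities because, after completing the
square, the log-likelihood ratio is a decreasing affine function of `‖y - (σ_y² / σ_x²) x‖²`
(`logLik_eq`), and the law of `‖Z‖²`, `Z ∼ N(m, I)`, depends on `m` only through `‖m‖²`
(`map_sum_sq_gaussLaw`, by characteristic functions).

Both cases of the integral representation are one statement about a chi-squared law with threshold
`k e^θ` and parameter `k e^{-θ}`, where `k = n / (2 sinh γ)`. Its Laplace transform is
`(1 + 2τ)^{-n/2} exp (-s τ / (1 + 2τ))`, and Fourier inversion (`exp_mul_real_Iic_eq_integral`)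
gives the distribution function as an integral over a vertical line `Re τ = σ`. In the variable
`z = e^θ (1 + 2τ)` the integrand is `e^{-k α(ln z)} / (z - e^θ)` up to a constant factor, and `σ` is
chosen so that the line passes through the saddle point `e^γ`. If `θ < γ` then `σ > 0` and the
inversion formula gives the distribution function; if `γ < θ` then `-1/2 < σ < 0` and it gives the
complementary distribution function, which is the source of the unit step. Choosing the tail in this
way means that the contour never has to cross the pole `e^θ`.

The path `u ↦ t(u)` is the steepest descent path through `e^γ`. With `w = a + ib = ln z`, the
equation `α(w) = u² / 2` says that `sinh a sin b = b sinh γ` and `Re α = u² / 2`. On the curve given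
by the first equation `Re α` increases strictly from `0` to `∞` with `b ∈ (0, π)`
(`alphaC_lt_of_im_lt`, `exists_alphaC_eq`), so there is one solution in each of the upper and lower
half planes; it is differentiable in `u` by the inverse function theorem
(`hasDerivAt_descentPath`).

By conjugation symmetry only the upper halves of the line and of the path matter. There `w` is in
the convex strip `0 < Im w < π`, in which the integrand has no pole and hence has a primitive. Both
curves lead from `γ` to `∞` inside the region `Re z ≤ e^γ ≤ |z|`, where the integrand is
`O(e^{-n Re w / 2})`; so the primitive has the same limits along both, and the integrals agree
(`exists_integral_logKernel_eq`). On the path the integrand is `-f(u) e^{-n u² / (4 sinh γ)}`, which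
is integrable because `Re w` and `Im w` both increase along it
(`integrableOn_descentVelocity_mul_exp`).
-/

namespace AWGN

open Filter Topology FourierTransform

/-! ### Inversion of the Laplace transform of a distribution function -/

lemma integrable_exp_mul_indicator_prod (ν : Measure ℝ) [IsProbabilityMeasure ν] {σ : ℝ}
    (hσ : 0 < σ) (hint : Integrable (fun x => Real.exp (-σ * x)) ν) :
    Integrable (fun p : ℝ × ℝ => (Ici p.2).indicator (fun u => Real.exp (-σ * u)) p.1)
      (volume.prod ν) := by
  have hmeas : Measurable
      (fun p : ℝ × ℝ => (Ici p.2).indicator (fun u => Real.exp (-σ * u)) p.1) := by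
    have : (fun p : ℝ × ℝ => (Ici p.2).indicator (fun u => Real.exp (-σ * u)) p.1) =
        {p : ℝ × ℝ | p.2 ≤ p.1}.indicator (fun p => Real.exp (-σ * p.1)) := by
      ext p; simp [indicator]
    rw [this]
    exact Measurable.indicator (by fun_prop) (measurableSet_le measurable_snd measurable_fst)
  rw [integrable_prod_iff' hmeas.aestronglyMeasurable]
  refine ⟨Eventually.of_forall fun x => ?_, ?_⟩
  · rw [integrable_indicator_iff measurableSet_Ici, integrableOn_Ici_iff_integrableOn_Ioi]
    exact integrableOn_exp_mul_Ioi (by linarith) x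
  · refine (hint.const_mul (1 / σ)).congr (Eventually.of_forall fun x => ?_)
    simp only [norm_indicator_eq_indicator_norm]
    rw [integral_indicator measurableSet_Ici, integral_Ici_eq_integral_Ioi]
    simp only [Real.norm_eq_abs, Real.abs_exp]
    rw [integral_exp_mul_Ioi (by linarith)]
    field_simp

lemma integral_exp_mul_indicator_Iic (ν : Measure ℝ) [IsProbabilityMeasure ν] (σ u : ℝ) :
    ∫ x, (Ici x).indicator (fun u => Real.exp (-σ * u)) u ∂ν =
      Real.exp (-σ * u) * ν.real (Iic u) := by
  have : (fun x => (Ici x).indicator (fun u => Real.exp (-σ * u)) u) =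
      (Iic u).indicator (fun _ => Real.exp (-σ * u)) := by
    ext x; simp [indicator]
  rw [this, integral_indicator measurableSet_Iic, setIntegral_const, smul_eq_mul, mul_comm]

/-- Fubini: `ν (Iic u)` is the integral over `x` of the indicator of `x ≤ u`, and `e^{-su}`
integrates to `e^{-sx} / s` over `u ≥ x`. -/
lemma fourier_exp_mul_cdf (ν : Measure ℝ) [IsProbabilityMeasure ν] {σ : ℝ}
    (hσ : 0 < σ) (hint : Integrable (fun x => Real.exp (-σ * x)) ν) (y : ℝ) :
    𝓕 (fun u : ℝ => ((Real.exp (-σ * u) * ν.real (Iic u) : ℝ) : ℂ)) y =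
      complexMGF id ν (-(σ + 2 * Real.pi * y * Complex.I)) / (σ + 2 * Real.pi * y * Complex.I) := by
  set s : ℂ := σ + 2 * Real.pi * y * Complex.I with hs
  have hsre : s.re = σ := by simp [hs]
  have hs0 : s ≠ 0 := fun h => hσ.ne' (by rw [← hsre, h]; rfl)
  have hP := integrable_exp_mul_indicator_prod ν hσ hint
  have hker : ∀ u x : ℝ, Complex.exp (((-2 * Real.pi * u * y : ℝ) : ℂ) * Complex.I) *
      (((Ici x).indicator (fun u => Real.exp (-σ * u)) u : ℝ) : ℂ) =
      (Ici x).indicator (fun u : ℝ => Complex.exp (-s * u)) u := by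
    intro u x
    by_cases h : x ≤ u
    · simp only [indicator, mem_Ici, h, if_true, Complex.ofReal_exp, ← Complex.exp_add, hs]
      congr 1; push_cast; ring
    · simp [indicator, h]
  have hP2 : Integrable (fun p : ℝ × ℝ =>
      (Ici p.2).indicator (fun u : ℝ => Complex.exp (-s * u)) p.1) (volume.prod ν) := by
    simp_rw [← hker]
    refine Integrable.bdd_mul (c := 1) hP.ofReal ?_ ?_
    · exact Measurable.aestronglyMeasurable (by fun_prop)
    · exact Eventually.of_forall fun p => by rw [Complex.norm_exp_ofReal_mul_I]
  rw [Real.fourier_real_eq_integral_exp_smul]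
  have h1 : ∀ u : ℝ, Complex.exp (((-2 * Real.pi * u * y : ℝ) : ℂ) * Complex.I) •
      ((Real.exp (-σ * u) * ν.real (Iic u) : ℝ) : ℂ) =
      ∫ x, (Ici x).indicator (fun u : ℝ => Complex.exp (-s * u)) u ∂ν := by
    intro u
    rw [← integral_exp_mul_indicator_Iic, ← integral_complex_ofReal, smul_eq_mul,
      ← integral_const_mul]
    exact integral_congr_ae (Eventually.of_forall fun x => hker u x)
  simp_rw [h1]
  rw [integral_integral_swap hP2, complexMGF, ← integral_div]
  refine integral_congr_ae (Eventually.of_forall fun x => ?_)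
  simp only [id]
  rw [integral_indicator measurableSet_Ici, integral_Ici_eq_integral_Ioi,
    integral_exp_mul_complex_Ioi (by simpa [hsre] using hσ)]
  field_simp

lemma continuousAt_real_Iic (ν : Measure ℝ) [IsProbabilityMeasure ν] {a : ℝ} (ha : ν {a} = 0) :
    ContinuousAt (fun u => ν.real (Iic u)) a := by
  have h : (fun u => ν.real (Iic u)) = cdf ν := by ext u; rw [cdf_eq_real]
  rw [h]
  have h1 : (cdf ν).measure {a} = 0 := by rw [measure_cdf, ha]
  rw [StieltjesFunction.measure_singleton, ENNReal.ofReal_eq_zero, sub_nonpos] at h1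
  have h2 := (monotone_cdf ν).continuousWithinAt_Iio_iff_leftLim_eq.2
    (le_antisymm ((monotone_cdf ν).leftLim_le le_rfl) h1)
  exact continuousAt_iff_continuous_left'_right'.2
    ⟨h2, ((cdf ν).right_continuous a).mono Ioi_subset_Ici_self⟩

/-- Inversion of the two-sided Laplace transform of a distribution function on a vertical line in
the right half plane, at a point that is not an atom. -/
lemma exp_mul_real_Iic_eq_integral (ν : Measure ℝ) [IsProbabilityMeasure ν] {σ a : ℝ}
    (hσ : 0 < σ) (hint : Integrable (fun x => Real.exp (-σ * x)) ν) (ha : ν {a} = 0)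
    (hM : Integrable fun y : ℝ => complexMGF id ν (-(σ + 2 * Real.pi * y * Complex.I)) /
      (σ + 2 * Real.pi * y * Complex.I)) :
    ((Real.exp (-σ * a) * ν.real (Iic a) : ℝ) : ℂ) =
      ∫ y : ℝ, Complex.exp (2 * Real.pi * y * a * Complex.I) *
        (complexMGF id ν (-(σ + 2 * Real.pi * y * Complex.I)) /
          (σ + 2 * Real.pi * y * Complex.I)) := by
  have hg : Integrable (fun u : ℝ => ((Real.exp (-σ * u) * ν.real (Iic u) : ℝ) : ℂ)) := by
    have := (integrable_exp_mul_indicator_prod ν hσ hint).integral_prod_left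
    simp only [integral_exp_mul_indicator_Iic] at this
    exact this.ofReal
  have hF := funext (fourier_exp_mul_cdf ν hσ hint)
  have hc : ContinuousAt (fun u : ℝ => ((Real.exp (-σ * u) * ν.real (Iic u) : ℝ) : ℂ)) a :=
    Complex.continuous_ofReal.continuousAt.comp
      (ContinuousAt.mul (by fun_prop) (continuousAt_real_Iic ν ha))
  have key := hg.fourierInv_fourier_eq (by rw [hF]; exact hM) hc
  rw [← key, hF, Real.fourierInv_eq']
  refine integral_congr_ae (Eventually.of_forall fun y => ?_)
  simp only [smul_eq_mul]
  congr 2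
  simp
  ring

/-! ### Laplace transform of the non-central chi-squared law -/

/-- The power `(1 - 2τ)^{-1/2}` is written with the logarithm, so that products of such powers
need no branch considerations. -/
lemma integral_cexp_mul_sq_gaussianReal (m : ℝ) {τ : ℂ} (hτ : τ.re < 1 / 2) :
    ∫ x, Complex.exp (τ * x ^ 2) ∂(gaussianReal m 1) =
      Complex.exp (-(1 / 2) * Complex.log (1 - 2 * τ) + τ * m ^ 2 / (1 - 2 * τ)) := by
  have hre : 0 < (1 - 2 * τ).re := by simp; linarith
  have h0 : (1 - 2 * τ) ≠ 0 := fun h => by rw [h] at hre; simp at hre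
  have harg : (1 - 2 * τ).arg ≠ Real.pi := by
    intro h
    rw [Complex.arg_eq_pi_iff] at h
    linarith [h.1]
  rw [integral_gaussianReal_eq_integral_smul one_ne_zero]
  have h1 : ∀ x : ℝ, gaussianPDFReal m 1 x • Complex.exp (τ * x ^ 2) =
      ((√(2 * Real.pi))⁻¹ : ℝ) *
        Complex.exp ((τ - 1 / 2) * x ^ 2 + m * x + (-(m ^ 2) / 2 : ℂ)) := by
    intro x
    rw [gaussianPDFReal, Complex.real_smul]
    push_cast
    rw [mul_assoc, ← Complex.exp_add]
    simp only [mul_one]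
    congr 2
    ring
  simp_rw [h1]
  rw [integral_const_mul, integral_cexp_quadratic (by simp; linarith)]
  have h2 : (Real.pi : ℂ) / -(τ - 1 / 2) = ((2 * Real.pi : ℝ) : ℂ) * (1 - 2 * τ)⁻¹ := by
    have : -(τ - 1 / 2) = (1 - 2 * τ) / 2 := by ring
    rw [this]; push_cast; field_simp
  have h3 : ((√(2 * Real.pi))⁻¹ : ℝ) = Real.exp (-(1 / 2) * Real.log (2 * Real.pi)) := by
    rw [Real.sqrt_eq_rpow, ← Real.rpow_neg (by positivity), Real.rpow_def_of_pos (by positivity)]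
    congr 1; ring
  have h4 : (Real.pi : ℂ) / -(τ - 1 / 2) ≠ 0 := by
    rw [h2]
    refine mul_ne_zero ?_ (inv_ne_zero h0)
    exact_mod_cast (by positivity : (2 * Real.pi) ≠ 0)
  rw [Complex.cpow_def_of_ne_zero h4, h2,
    Complex.log_ofReal_mul (by positivity) (inv_ne_zero h0), Complex.log_inv _ harg, h3,
    Complex.ofReal_exp, ← Complex.exp_add, ← Complex.exp_add]
  congr 1
  push_cast
  have h6 : (4 * (τ - 1 / 2)) = -2 * (1 - 2 * τ) := by ring
  rw [h6]
  field_simp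
  ring

lemma complexMGF_sum_sq_gaussLaw {n : ℕ} (m : Fin n → ℝ) {τ : ℂ} (hτ : τ.re < 1 / 2) :
    complexMGF (fun z => ∑ i, z i ^ 2) (gaussLaw m 1) τ =
      Complex.exp (-(n / 2) * Complex.log (1 - 2 * τ) +
        τ * (∑ i, m i ^ 2 : ℝ) / (1 - 2 * τ)) := by
  have h1 : ∀ z : Fin n → ℝ, Complex.exp (τ * ((∑ i, z i ^ 2 : ℝ) : ℂ)) =
      ∏ i, Complex.exp (τ * (z i) ^ 2) := by
    intro z
    rw [← Complex.exp_sum]; push_cast; rw [Finset.mul_sum]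
  rw [complexMGF, gaussLaw]
  simp_rw [h1]
  rw [integral_fintype_prod_eq_prod (fun i (x : ℝ) => Complex.exp (τ * x ^ 2))]
  simp_rw [integral_cexp_mul_sq_gaussianReal _ hτ]
  rw [← Complex.exp_sum, Finset.sum_add_distrib, ← Finset.sum_div, ← Finset.mul_sum]
  simp [Finset.mul_sum]
  ring_nf

lemma measurable_sum_sq {n : ℕ} : Measurable (fun z : Fin n → ℝ => ∑ i, z i ^ 2) := by
  fun_prop

instance {n : ℕ} (m : Fin n → ℝ) (v : ℝ≥0) : IsProbabilityMeasure (gaussLaw m v) := by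
  unfold gaussLaw; infer_instance

instance (n : ℕ) (s : ℝ) : IsProbabilityMeasure (chiSq n s) := by
  unfold chiSq
  exact Measure.isProbabilityMeasure_map measurable_sum_sq.aemeasurable

/-- The law of `‖Z‖²`, `Z ∼ N(m, I)`, depends on `m` only through `‖m‖²`. -/
lemma map_sum_sq_gaussLaw {n : ℕ} (hn : 1 ≤ n) (m : Fin n → ℝ) :
    (gaussLaw m 1).map (fun z => ∑ i, z i ^ 2) = chiSq n (∑ i, m i ^ 2) := by
  have : IsProbabilityMeasure ((gaussLaw m 1).map (fun z => ∑ i, z i ^ 2)) :=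
    Measure.isProbabilityMeasure_map measurable_sum_sq.aemeasurable
  refine Measure.ext_of_charFun (funext fun t => ?_)
  have hre : ((t : ℂ) * Complex.I).re < 1 / 2 := by simp
  rw [← complexMGF_mul_I measurable_sum_sq.aemeasurable, chiSq,
    ← complexMGF_mul_I measurable_sum_sq.aemeasurable,
    complexMGF_sum_sq_gaussLaw _ hre, complexMGF_sum_sq_gaussLaw _ hre]
  have hn' : (n : ℝ) ≠ 0 := by positivity
  have : (0 : ℝ) ≤ (∑ i, m i ^ 2) / n := by positivity
  simp only [Finset.sum_const, Finset.card_univ, Fintype.card_fin, nsmul_eq_mul, Real.sq_sqrt this]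
  rw [mul_div_cancel₀ _ hn']

lemma complexMGF_chiSq {n : ℕ} (hn : 1 ≤ n) {s : ℝ} (hs : 0 ≤ s) {τ : ℂ} (hτ : τ.re < 1 / 2) :
    complexMGF id (chiSq n s) τ =
      Complex.exp (-(n / 2) * Complex.log (1 - 2 * τ) + τ * s / (1 - 2 * τ)) := by
  rw [chiSq, complexMGF_id_map measurable_sum_sq.aemeasurable, complexMGF_sum_sq_gaussLaw _ hτ]
  have hn' : (n : ℝ) ≠ 0 := by positivity
  have : (0 : ℝ) ≤ s / n := by positivity
  simp only [Finset.sum_const, Finset.card_univ, Fintype.card_fin, nsmul_eq_mul, Real.sq_sqrt this]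
  rw [mul_div_cancel₀ _ hn']

lemma integrable_exp_mul_chiSq {n : ℕ} (hn : 1 ≤ n) {s : ℝ} (hs : 0 ≤ s) {σ : ℝ}
    (hσ : σ < 1 / 2) : Integrable (fun x => Real.exp (σ * x)) (chiSq n s) := by
  -- A divergent integral would have the junk value `0`, but the transform does not vanish.
  by_contra h
  have := complexMGF_undef (X := id) (μ := chiSq n s) (z := σ) (by fun_prop) (by simpa using h)
  rw [complexMGF_chiSq hn hs (by simpa using hσ)] at this
  exact Complex.exp_ne_zero _ this

lemma chiSq_singleton {n : ℕ} (hn : 1 ≤ n) (s a : ℝ) : chiSq n s {a} = 0 := by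
  obtain ⟨k, rfl⟩ : ∃ k, n = k + 1 := ⟨n - 1, by omega⟩
  have hmeas : Measurable (fun z : Fin (k + 1) → ℝ => ∑ i, z i ^ 2) := measurable_sum_sq
  rw [chiSq, Measure.map_apply hmeas (measurableSet_singleton a), gaussLaw]
  set μ : Fin (k + 1) → Measure ℝ := fun i => gaussianReal (√(s / (k + 1 : ℕ))) 1
  have : NullSingletonClass (gaussianReal (√(s / (k + 1 : ℕ))) 1) :=
    nullSingletonClass_gaussianReal one_ne_zero
  have hmp := (measurePreserving_piFinSuccAbove μ 0).symm
  rw [← hmp.measure_preimage (hmeas (measurableSet_singleton a)).nullMeasurableSet]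
  have hS : MeasurableSet ((MeasurableEquiv.piFinSuccAbove (fun _ => ℝ) 0).symm ⁻¹'
      ((fun z : Fin (k + 1) → ℝ => ∑ i, z i ^ 2) ⁻¹' {a})) :=
    hmp.measurable (hmeas (measurableSet_singleton a))
  rw [Measure.prod_apply_symm hS, lintegral_eq_zero_iff (measurable_measure_prodMk_right hS)]
  refine Eventually.of_forall fun r => ?_
  have hfin : ((fun x => (x, r)) ⁻¹' ((MeasurableEquiv.piFinSuccAbove (fun _ => ℝ) 0).symm ⁻¹'
      ((fun z : Fin (k + 1) → ℝ => ∑ i, z i ^ 2) ⁻¹' {a}))).Finite := by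
    refine Set.Finite.subset (s := {√(a - ∑ i, r i ^ 2), -√(a - ∑ i, r i ^ 2)})
      (by simp) fun x hx => ?_
    have hx' : x ^ 2 + ∑ i, r i ^ 2 = a := by
      simpa [MeasurableEquiv.piFinSuccAbove_symm_apply, Fin.insertNthEquiv, Fin.sum_univ_succ]
        using hx
    have h : a - ∑ i, r i ^ 2 = x ^ 2 := by linarith
    simp only [mem_insert_iff, mem_singleton_iff, h, Real.sqrt_sq_eq_abs]
    rcases abs_choice x with h | h <;> simp [h]
  exact hfin.measure_zero (gaussianReal (√(s / (k + 1 : ℕ))) 1)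

/-- A scaled squared distance of a Gaussian vector to a point has a non-central chi-squared law. -/
lemma map_sum_sub_sq_gaussLaw {n : ℕ} (hn : 1 ≤ n) (m c : Fin n → ℝ) {v : ℝ≥0} (hv : 0 < v) :
    (gaussLaw m v).map (fun y => (∑ i, (y i - c i) ^ 2) / (v : ℝ)) =
      chiSq n ((∑ i, (m i - c i) ^ 2) / v) := by
  have hv' : (0 : ℝ) < v := hv
  have h1 : ∀ i, (gaussianReal (m i) v).map (fun y => (y - c i) / √v) =
      gaussianReal ((m i - c i) / √v) 1 := by
    intro i
    rw [show (fun y => (y - c i) / √v) = (fun y => y / √(v : ℝ)) ∘ (fun y => y - c i) from rfl,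
      ← Measure.map_map (by fun_prop) (by fun_prop), gaussianReal_map_sub_const,
      gaussianReal_map_div_const]
    congr 1
    ext
    simp [Real.sq_sqrt hv'.le, hv'.ne']
  have h2 : gaussLaw (fun i => (m i - c i) / √v) 1 =
      (gaussLaw m v).map (fun y i => (y i - c i) / √v) := by
    have : ∀ i, SigmaFinite ((gaussianReal (m i) v).map (fun y => (y - c i) / √v)) := by
      intro i; rw [h1]; infer_instance
    have h := Measure.pi_map_pi (μ := fun i => gaussianReal (m i) v)
      (f := fun i y => (y - c i) / √v) (fun i => by fun_prop)
    simp_rw [h1] at h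
    exact h.symm
  have h3 := map_sum_sq_gaussLaw hn (fun i => (m i - c i) / √v)
  rw [h2, Measure.map_map measurable_sum_sq (by fun_prop)] at h3
  simpa [Function.comp_def, div_pow, Real.sq_sqrt hv'.le, ← Finset.sum_div] using h3

/-! ### The log-likelihood ratio -/

lemma log_gaussDensity {n : ℕ} (a : Fin n → ℝ) {v : ℝ≥0} (hv : 0 < v) (b : Fin n → ℝ) :
    Real.log (gaussDensity a v b) =
      -(n / 2) * Real.log (2 * Real.pi * v) - (∑ i, (b i - a i) ^ 2) / (2 * v) := by
  have hv' : (0 : ℝ) < v := hv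
  rw [gaussDensity, Real.log_prod fun i _ => (gaussianPDFReal_pos _ _ _ hv.ne').ne']
  have h : ∀ i, Real.log (gaussianPDFReal (a i) v (b i)) =
      -(1 / 2) * Real.log (2 * Real.pi * v) - (b i - a i) ^ 2 / (2 * v) := by
    intro i
    rw [gaussianPDFReal, Real.log_mul (by positivity) (by positivity), Real.log_exp, Real.log_inv,
      Real.log_sqrt (by positivity)]
    ring
  simp_rw [h]
  rw [Finset.sum_sub_distrib, ← Finset.sum_div]
  simp
  ring

lemma gaussDensity_pos {n : ℕ} (a : Fin n → ℝ) {v : ℝ≥0} (hv : 0 < v) (b : Fin n → ℝ) :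
    0 < gaussDensity a v b :=
  Finset.prod_pos fun _ _ => gaussianPDFReal_pos _ _ _ hv.ne'

/-- Completing the square in the exponent turns the log-likelihood ratio into a decreasing affine
function of the squared distance to the point `(σ_y² / σ_x²) x`. -/
lemma logLik_eq {n : ℕ} (hn : 1 ≤ n) {vx vw : ℝ≥0} (hvx : 0 < vx) (hvw : 0 < vw)
    {x : Fin n → ℝ} (hx : x ∈ constEnergy n vx) (y : Fin n → ℝ) :
    2 * logLik vx vw x y = 1 + Real.log (1 + snr vx vw) -
      snr vx vw / (1 + snr vx vw) * ((∑ i, (y i - (vx + vw) / vx * x i) ^ 2) / (n * vw)) := by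
  have hvx' : (0 : ℝ) < vx := hvx
  have hvw' : (0 : ℝ) < vw := hvw
  have hn' : (0 : ℝ) < n := by exact_mod_cast hn
  have hx' : ∑ i, x i ^ 2 = n * (vx : ℝ) := hx
  have e1 : ∀ c : ℝ, ∑ i, (y i - c * x i) ^ 2 =
      ∑ i, y i ^ 2 - 2 * c * ∑ i, y i * x i + c ^ 2 * (n * (vx : ℝ)) := by
    intro c
    rw [← hx', Finset.mul_sum, Finset.mul_sum, ← Finset.sum_sub_distrib, ← Finset.sum_add_distrib]
    exact Finset.sum_congr rfl fun i _ => by ring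
  have e2 : ∑ i, (y i - x i) ^ 2 = ∑ i, y i ^ 2 - 2 * ∑ i, y i * x i + n * (vx : ℝ) := by
    simpa using e1 1
  rw [logLik, Real.log_div (gaussDensity_pos _ hvw _).ne'
    (gaussDensity_pos _ (add_pos hvx hvw) _).ne', log_gaussDensity _ hvw,
    log_gaussDensity _ (add_pos hvx hvw), e2, e1]
  have hlog : Real.log (2 * Real.pi * (vx + vw)) =
      Real.log (2 * Real.pi * vw) + Real.log (1 + vx / vw) := by
    rw [← Real.log_mul (by positivity) (by positivity)]
    congr 1
    field_simp
    ring
  simp only [NNReal.coe_add, hlog, Pi.zero_apply, sub_zero, snr]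
  field_simp
  ring

lemma probMD_eq_chiSqCCDF {n : ℕ} (hn : 1 ≤ n) {vx vw : ℝ≥0} (hvx : 0 < vx) (hvw : 0 < vw)
    {x : Fin n → ℝ} (hx : x ∈ constEnergy n vx) {lam lam' : ℝ}
    (hlam : 2 * lam = 1 + Real.log (1 + snr vx vw) - snr vx vw / (1 + snr vx vw) * lam') :
    probMD vx vw x lam = chiSqCCDF (n * lam') n (n / snr vx vw) := by
  have hvx' : (0 : ℝ) < vx := hvx
  have hvw' : (0 : ℝ) < vw := hvw
  have hn' : (0 : ℝ) < n := by exact_mod_cast hn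
  have hsnr : 0 < snr vx vw := div_pos hvx' hvw'
  have hx' : ∑ i, x i ^ 2 = n * (vx : ℝ) := hx
  have hlaw := map_sum_sub_sq_gaussLaw hn x (fun i => (vx + vw) / vx * x i) hvw
  have hs : (∑ i, (x i - (vx + vw) / vx * x i) ^ 2) / (vw : ℝ) = n / snr vx vw := by
    have : ∀ i, (x i - (vx + vw) / vx * x i) ^ 2 = ((vw : ℝ) / vx) ^ 2 * x i ^ 2 := by
      intro i; field_simp; ring
    simp_rw [this]
    rw [← Finset.mul_sum, hx', snr]
    field_simp
  rw [hs] at hlaw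
  rw [probMD, chiSqCCDF, ← hlaw, map_measureReal_apply (by fun_prop) measurableSet_Ioi]
  congr 1
  ext y
  simp only [mem_ofPred_eq, mem_preimage, mem_Ioi]
  have h := logLik_eq hn hvx hvw hx y
  have hc : 0 < snr vx vw / (1 + snr vx vw) := by positivity
  rw [show logLik vx vw x y < lam ↔ 2 * logLik vx vw x y < 2 * lam by
      constructor <;> intro <;> linarith, h, hlam, sub_lt_sub_iff_left, mul_lt_mul_iff_right₀ hc,
    lt_div_iff₀ (by positivity),
    lt_div_iff₀ (by positivity)]
  constructor <;> intro <;> linarith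

lemma probFA_eq_chiSqCDF {n : ℕ} (hn : 1 ≤ n) {vx vw : ℝ≥0} (hvx : 0 < vx) (hvw : 0 < vw)
    {x : Fin n → ℝ} (hx : x ∈ constEnergy n vx) {lam lam' : ℝ}
    (hlam : 2 * lam = 1 + Real.log (1 + snr vx vw) - snr vx vw / (1 + snr vx vw) * lam') :
    probFA vx vw x lam =
      chiSqCDF (n * lam' / (1 + snr vx vw)) n (n * ((1 + snr vx vw) / snr vx vw)) := by
  have hvx' : (0 : ℝ) < vx := hvx
  have hvw' : (0 : ℝ) < vw := hvw
  have hn' : (0 : ℝ) < n := by exact_mod_cast hn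
  have hsnr : 0 < snr vx vw := div_pos hvx' hvw'
  have hx' : ∑ i, x i ^ 2 = n * (vx : ℝ) := hx
  have hlaw := map_sum_sub_sq_gaussLaw hn 0 (fun i => (vx + vw) / vx * x i) (add_pos hvx hvw)
  have hs : (∑ i, ((0 : Fin n → ℝ) i - (vx + vw) / vx * x i) ^ 2) / ((vx + vw : ℝ≥0) : ℝ) =
      n * ((1 + snr vx vw) / snr vx vw) := by
    have : ∀ i, ((0 : Fin n → ℝ) i - (vx + vw) / vx * x i) ^ 2 =
        (((vx : ℝ) + vw) / vx) ^ 2 * x i ^ 2 := by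
      intro i; simp only [Pi.zero_apply]; ring
    simp_rw [this]
    rw [← Finset.mul_sum, hx', snr, NNReal.coe_add]
    field_simp
    ring
  rw [hs] at hlaw
  rw [probFA, chiSqCDF, ← hlaw, map_measureReal_apply (by fun_prop) measurableSet_Iic]
  congr 1
  ext y
  simp only [mem_ofPred_eq, mem_preimage, mem_Iic]
  have h := logLik_eq hn hvx hvw hx y
  have hc : 0 < snr vx vw / (1 + snr vx vw) := by positivity
  have hv : ((vx + vw : ℝ≥0) : ℝ) = vw * (1 + snr vx vw) := by
    rw [NNReal.coe_add, snr]; field_simp; ring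
  rw [show lam ≤ logLik vx vw x y ↔ 2 * lam ≤ 2 * logLik vx vw x y by
      constructor <;> intro <;> linarith, h, hlam, sub_le_sub_iff_left, mul_le_mul_iff_right₀ hc,
    div_le_iff₀ (by positivity), hv,
    div_le_iff₀ (by positivity)]
  have : n * lam' / (1 + snr vx vw) * (vw * (1 + snr vx vw)) = lam' * (n * vw) := by
    field_simp
  rw [this]

/-! ### The equation `α(w) = r` in the strip `0 < Im w < π` -/

lemma alphaC_eq (γ : ℝ) (w : ℂ) : alphaC γ w = (Real.cosh γ : ℂ) -
    (Real.cosh w.re * Real.cos w.im + Real.sinh w.re * Real.sin w.im * Complex.I) +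
      (Real.sinh γ : ℂ) * (w - γ) := by
  have h : Complex.cosh w = Real.cosh w.re * Real.cos w.im +
      Real.sinh w.re * Real.sin w.im * Complex.I := by
    conv_lhs => rw [← Complex.re_add_im w]
    rw [Complex.cosh_add, Complex.cosh_mul_I, Complex.sinh_mul_I]
    push_cast; ring
  rw [alphaC, h]; push_cast; rfl

lemma alphaC_re (γ : ℝ) (w : ℂ) : (alphaC γ w).re =
    Real.cosh γ - Real.cosh w.re * Real.cos w.im + Real.sinh γ * (w.re - γ) := by
  rw [alphaC_eq]
  simp [-Complex.ofReal_cosh, -Complex.ofReal_sinh, -Complex.ofReal_cos, -Complex.ofReal_sin]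

lemma alphaC_im (γ : ℝ) (w : ℂ) : (alphaC γ w).im =
    Real.sinh γ * w.im - Real.sinh w.re * Real.sin w.im := by
  rw [alphaC_eq]
  simp [-Complex.ofReal_cosh, -Complex.ofReal_sinh, -Complex.ofReal_cos, -Complex.ofReal_sin]
  ring

lemma alphaC_conj (γ : ℝ) (w : ℂ) :
    alphaC γ (starRingEnd ℂ w) = starRingEnd ℂ (alphaC γ w) := by
  apply Complex.ext
  · simp [alphaC_re]
  · simp [alphaC_im]; ring

lemma hasStrictDerivAt_alphaC (γ : ℝ) (w : ℂ) :
    HasStrictDerivAt (alphaC γ) (Complex.sinh γ - Complex.sinh w) w := by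
  have h := ((hasStrictDerivAt_const w (Complex.cosh γ)).sub (Complex.hasStrictDerivAt_cosh w)).add
    ((hasStrictDerivAt_const w (Complex.sinh γ)).mul ((hasStrictDerivAt_id w).sub_const (γ : ℂ)))
  convert! h using 1
  simp
  ring

lemma mul_cos_le_sin {b : ℝ} (hb : 0 < b) (hb' : b < Real.pi) : b * Real.cos b ≤ Real.sin b := by
  rcases lt_or_ge b (Real.pi / 2) with h | h
  · have hc : 0 < Real.cos b := Real.cos_pos_of_mem_Ioo ⟨by linarith, h⟩
    have := Real.lt_tan hb h
    rw [Real.tan_eq_sin_div_cos, lt_div_iff₀ hc] at this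
    exact this.le
  · have hc : Real.cos b ≤ 0 := Real.cos_nonpos_of_pi_div_two_le_of_le h (by linarith)
    have := Real.sin_pos_of_pos_of_lt_pi hb hb'
    nlinarith

lemma mul_sin_le_mul_sin {b₁ b₂ : ℝ} (h₁ : 0 < b₁) (h : b₁ ≤ b₂) (h₂ : b₂ ≤ Real.pi) :
    b₁ * Real.sin b₂ ≤ b₂ * Real.sin b₁ := by
  have hb2 : 0 < b₂ := by linarith
  have hc := strictConcaveOn_sin_Icc.concaveOn.2
    (show (0 : ℝ) ∈ Icc 0 Real.pi from ⟨le_rfl, Real.pi_pos.le⟩)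
    (show b₂ ∈ Icc 0 Real.pi from ⟨hb2.le, h₂⟩)
    (show 0 ≤ 1 - b₁ / b₂ by rw [sub_nonneg, div_le_one hb2]; exact h)
    (show 0 ≤ b₁ / b₂ by positivity) (by ring)
  simp only [smul_eq_mul, Real.sin_zero, mul_zero, zero_add] at hc
  rw [div_mul_cancel₀ _ hb2.ne', div_mul_eq_mul_div, div_le_iff₀ hb2] at hc
  linarith

lemma cosh_sub_cosh_le (a₁ a₂ : ℝ) :
    Real.cosh a₂ - Real.cosh a₁ ≤ Real.sinh a₂ * (a₂ - a₁) := by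
  have h1 := mul_le_mul_of_nonneg_left (Real.add_one_le_exp (a₁ - a₂)) (Real.exp_pos a₂).le
  have h2 := mul_le_mul_of_nonneg_left (Real.add_one_le_exp (-a₁ - -a₂)) (Real.exp_pos (-a₂)).le
  rw [← Real.exp_add] at h1 h2
  rw [show a₂ + (a₁ - a₂) = a₁ by ring] at h1
  rw [show -a₂ + (-a₁ - -a₂) = -a₁ by ring] at h2
  rw [Real.cosh_eq, Real.cosh_eq, Real.sinh_eq]
  nlinarith

/-- For fixed `b`, `Re α` is nondecreasing in the real part `a` up to the curve `Im α = 0`. -/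
lemma alpha_re_mono {γ a₁ a₂ b : ℝ} (hγ : 0 < γ) (hb : 0 < b) (hb' : b < Real.pi)
    (h₁ : 0 ≤ a₁) (h : a₁ ≤ a₂) (hs : Real.sinh a₂ * Real.sin b ≤ Real.sinh γ * b) :
    Real.cosh γ - Real.cosh a₁ * Real.cos b + Real.sinh γ * (a₁ - γ) ≤
      Real.cosh γ - Real.cosh a₂ * Real.cos b + Real.sinh γ * (a₂ - γ) := by
  have hsγ : 0 < Real.sinh γ := Real.sinh_pos_iff.2 hγ
  have hcosh : Real.cosh a₁ ≤ Real.cosh a₂ := by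
    rw [Real.cosh_le_cosh, abs_of_nonneg h₁, abs_of_nonneg (h₁.trans h)]; exact h
  rcases le_or_gt (Real.cos b) 0 with hc | hc
  · nlinarith [mul_nonneg hsγ.le (sub_nonneg.2 h)]
  · have hsin := Real.sin_pos_of_pos_of_lt_pi hb hb'
    have h3 : Real.sinh a₂ * Real.cos b ≤ Real.sinh γ := by
      have h4 := mul_le_mul_of_nonneg_right hs hc.le
      have h5 := mul_le_mul_of_nonneg_left (mul_cos_le_sin hb hb') hsγ.le
      have h6 : (Real.sinh a₂ * Real.cos b) * Real.sin b ≤ Real.sinh γ * Real.sin b := by linarith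
      exact le_of_mul_le_mul_right h6 hsin
    have h7 := mul_le_mul_of_nonneg_right (cosh_sub_cosh_le a₁ a₂) hc.le
    have h8 := mul_le_mul_of_nonneg_right h3 (sub_nonneg.2 h)
    nlinarith

/-- On the curve `Im α = 0` one has `sinh a = sinh γ · b / sin b > sinh γ`. -/
lemma lt_re_of_alphaC_im_eq_zero {γ : ℝ} (hγ : 0 < γ) {w : ℂ} (hw : 0 < w.im) (hw' : w.im < Real.pi)
    (h : (alphaC γ w).im = 0) : γ < w.re := by
  have hsγ : 0 < Real.sinh γ := Real.sinh_pos_iff.2 hγ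
  have hsin := Real.sin_pos_of_pos_of_lt_pi hw hw'
  rw [alphaC_im] at h
  rw [← Real.sinh_lt_sinh]
  by_contra! hle
  have h1 := mul_lt_mul_of_pos_left (Real.sin_lt hw) hsγ
  have h2 := mul_le_mul_of_nonneg_right hle hsin.le
  linarith

/-- `Re α` increases strictly along the curve `Im α = 0`: when `b` grows, so does `b / sin b` and
hence `a`, and `Re α` increases in each of the two variables. -/
lemma alphaC_lt_of_im_lt {γ : ℝ} (hγ : 0 < γ) {w₁ w₂ : ℂ} (h₁ : 0 < w₁.im) (h₂ : w₂.im < Real.pi)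
    (h : w₁.im < w₂.im) (ha₁ : (alphaC γ w₁).im = 0) (ha₂ : (alphaC γ w₂).im = 0) :
    (alphaC γ w₁).re < (alphaC γ w₂).re := by
  have hsγ : 0 < Real.sinh γ := Real.sinh_pos_iff.2 hγ
  have hγ1 := lt_re_of_alphaC_im_eq_zero hγ h₁ (h.trans h₂) ha₁
  have hγ2 := lt_re_of_alphaC_im_eq_zero hγ (h₁.trans h) h₂ ha₂
  have hs1 := Real.sin_pos_of_pos_of_lt_pi h₁ (h.trans h₂)
  have hs2 := Real.sin_pos_of_pos_of_lt_pi (h₁.trans h) h₂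
  rw [alphaC_im] at ha₁ ha₂
  have hle : w₁.re ≤ w₂.re := by
    rw [← Real.sinh_le_sinh]
    have h3 := mul_le_mul_of_nonneg_left (mul_sin_le_mul_sin h₁ h.le h₂.le) hsγ.le
    have h4 : Real.sinh w₁.re * (Real.sin w₁.im * Real.sin w₂.im) ≤
        Real.sinh w₂.re * (Real.sin w₁.im * Real.sin w₂.im) := by
      calc _ = Real.sinh γ * w₁.im * Real.sin w₂.im := by
            rw [show Real.sinh γ * w₁.im = Real.sinh w₁.re * Real.sin w₁.im by linarith]; ring
        _ ≤ Real.sinh γ * w₂.im * Real.sin w₁.im := by linarith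
        _ = _ := by
            rw [show Real.sinh γ * w₂.im = Real.sinh w₂.re * Real.sin w₂.im by linarith]; ring
    exact le_of_mul_le_mul_right h4 (by positivity)
  have h5 := alpha_re_mono hγ (h₁.trans h) h₂ (hγ.trans hγ1).le hle (by linarith)
  rw [alphaC_re, alphaC_re]
  have h6 : Real.cos w₂.im < Real.cos w₁.im := Real.cos_lt_cos_of_nonneg_of_le_pi h₁.le h₂.le h
  have h7 := mul_lt_mul_of_pos_left h6 (Real.cosh_pos w₁.re)
  linarith

lemma alphaC_injective_of_im_eq_zero {γ : ℝ} (hγ : 0 < γ) {w₁ w₂ : ℂ} (h₁ : 0 < w₁.im)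
    (h₁' : w₁.im < Real.pi) (h₂ : 0 < w₂.im) (h₂' : w₂.im < Real.pi) {r : ℝ}
    (ha₁ : alphaC γ w₁ = r) (ha₂ : alphaC γ w₂ = r) : w₁ = w₂ := by
  have i1 : (alphaC γ w₁).im = 0 := by rw [ha₁]; simp
  have i2 : (alphaC γ w₂).im = 0 := by rw [ha₂]; simp
  have him : w₁.im = w₂.im := by
    rcases lt_trichotomy w₁.im w₂.im with h | h | h
    · have := alphaC_lt_of_im_lt hγ h₁ h₂' h i1 i2
      rw [ha₁, ha₂] at this; exact absurd this (lt_irrefl _)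
    · exact h
    · have := alphaC_lt_of_im_lt hγ h₂ h₁' h i2 i1
      rw [ha₁, ha₂] at this; exact absurd this (lt_irrefl _)
  refine Complex.ext ?_ him
  rw [alphaC_im] at i1 i2
  rw [him] at i1
  have hs2 := Real.sin_pos_of_pos_of_lt_pi h₂ h₂'
  exact Real.sinh_injective (mul_right_cancel₀ hs2.ne' (by linarith))

/-- Existence by the intermediate value theorem on the curve `a = arsinh (sinh γ · b / sin b)`,
which extends continuously to `b = 0`. -/
lemma exists_alphaC_eq {γ : ℝ} (hγ : 0 < γ) {r : ℝ} (hr : 0 < r) :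
    ∃ w : ℂ, 0 < w.im ∧ w.im < Real.pi ∧ alphaC γ w = r := by
  have hsγ : 0 < Real.sinh γ := Real.sinh_pos_iff.2 hγ
  set M := γ + r / Real.sinh γ with hM
  have hMγ : γ < M := by rw [hM]; linarith [div_pos hr hsγ]
  have hsM : Real.sinh γ < Real.sinh M := Real.sinh_lt_sinh.2 hMγ
  have hsM0 : 0 < Real.sinh M := hsγ.trans hsM
  -- At `b = π - δ` the real part is at least `M`, and `sinh γ * (M - γ) = r`.
  set δ := Real.pi / 2 * (Real.sinh γ / Real.sinh M) with hδ
  have hδ0 : 0 < δ := by positivity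
  have hδ1 : δ < Real.pi / 2 := by
    rw [hδ]
    exact mul_lt_of_lt_one_right (by positivity) ((div_lt_one hsM0).2 hsM)
  have hpi := Real.pi_pos
  have hsinc : ∀ b ∈ Icc (0 : ℝ) (Real.pi - δ), 0 < Real.sinc b := by
    intro b hb
    rcases hb.1.eq_or_lt with h | h
    · rw [← h]; simp
    · rw [Real.sinc_of_ne_zero h.ne']
      exact div_pos (Real.sin_pos_of_pos_of_lt_pi h (by linarith [hb.2])) h
  set A : ℝ → ℝ := fun b => Real.arsinh (Real.sinh γ / Real.sinc b) with hA
  set R : ℝ → ℝ := fun b =>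
    Real.cosh γ - Real.cosh (A b) * Real.cos b + Real.sinh γ * (A b - γ) with hR
  have hAc : ContinuousOn A (Icc 0 (Real.pi - δ)) := by
    refine Real.continuous_arsinh.comp_continuousOn ?_
    exact continuousOn_const.div Real.continuous_sinc.continuousOn fun b hb => (hsinc b hb).ne'
  have hRc : ContinuousOn R (Icc 0 (Real.pi - δ)) := by
    refine ContinuousOn.add (ContinuousOn.sub continuousOn_const (ContinuousOn.mul ?_ ?_)) ?_
    · exact Real.continuous_cosh.comp_continuousOn hAc
    · exact Real.continuous_cos.continuousOn
    · exact continuousOn_const.mul (hAc.sub continuousOn_const)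
  have hA0 : A 0 = γ := by simp only [hA, Real.sinc_zero, div_one, Real.arsinh_sinh]
  have hR0 : R 0 = 0 := by simp only [hR, hA0, Real.cos_zero]; ring
  have hR1 : r ≤ R (Real.pi - δ) := by
    have hcos : Real.cos (Real.pi - δ) ≤ 0 :=
      Real.cos_nonpos_of_pi_div_two_le_of_le (by linarith) (by linarith)
    have hAM : M ≤ A (Real.pi - δ) := by
      rw [hA, ← Real.arsinh_sinh M]
      refine Real.arsinh_le_arsinh.2 ?_
      rw [le_div_iff₀ (hsinc _ ⟨by linarith, le_rfl⟩), Real.sinc_of_ne_zero (by linarith),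
        Real.sin_pi_sub, ← mul_div_assoc, div_le_iff₀ (by linarith)]
      have h1 : Real.sin δ ≤ δ := Real.sin_le hδ0.le
      calc Real.sinh M * Real.sin δ ≤ Real.sinh M * δ := by gcongr
        _ = Real.sinh γ * (Real.pi / 2) := by rw [hδ]; field_simp
        _ ≤ _ := by gcongr; linarith
    have h2 : Real.sinh γ * (M - γ) = r := by rw [hM]; field_simp; ring
    have h3 : Real.sinh γ * (M - γ) ≤ Real.sinh γ * (A (Real.pi - δ) - γ) := by gcongr
    have h4 := mul_nonneg (Real.cosh_pos (A (Real.pi - δ))).le (neg_nonneg.2 hcos)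
    have h5 := Real.cosh_pos γ
    simp only [hR]
    linarith
  obtain ⟨b, hb, hbr⟩ := intermediate_value_Icc (by linarith) hRc ⟨hR0.trans_le hr.le, hR1⟩
  have hb0 : 0 < b := by
    refine hb.1.lt_of_ne ?_
    rintro rfl
    rw [hR0] at hbr; exact hr.ne hbr
  refine ⟨⟨A b, b⟩, hb0, by linarith [hb.2], Complex.ext ?_ ?_⟩
  · rw [alphaC_re]; exact hbr
  · rw [alphaC_im]
    simp only [hA, Real.sinh_arsinh, Complex.ofReal_im]
    rw [Real.sinc_of_ne_zero hb0.ne']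
    have := Real.sin_pos_of_pos_of_lt_pi hb0 (by linarith [hb.2])
    field_simp
    ring

/-! ### The function `t` and the steepest descent path -/

lemma sqrt_eq_ofReal_iff {a : ℂ} {r : ℝ} (hr : 0 ≤ r) :
    Complex.sqrt a = r ↔ a = (r : ℂ) ^ 2 := by
  constructor
  · intro h
    rw [← h, Complex.sqrt]
    exact (Complex.cpow_nat_inv_pow a two_ne_zero).symm
  · rintro rfl
    rw [← Complex.ofReal_pow, Complex.sqrt, ← Complex.ofReal_ofNat, ← Complex.ofReal_inv,
      ← Complex.ofReal_cpow (by positivity)]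
    congr 1
    rw [← Real.rpow_natCast, ← Real.rpow_mul hr]
    norm_num

/-- The principal root has nonnegative real part, so its sign cannot compensate for that
of `Im z`. -/
lemma tInv_eq_iff (γ : ℝ) {u : ℝ} (hu : u ≠ 0) (z : ℂ) :
    tInv γ z = u ↔
      Real.sign z.im = Real.sign u ∧ alphaC γ (Complex.log z) = ((u ^ 2 / 2 : ℝ) : ℂ) := by
  have hsq : ∀ a : ℂ, 2 * a = ((|u| : ℝ) : ℂ) ^ 2 ↔ a = ((u ^ 2 / 2 : ℝ) : ℂ) := by
    intro a
    rw [← Complex.ofReal_pow, sq_abs]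
    push_cast
    constructor
    · intro h; linear_combination h / 2
    · intro h; linear_combination 2 * h
  have hre : 0 ≤ (Complex.sqrt (2 * alphaC γ (Complex.log z))).re := by
    rw [Complex.sqrt, Complex.cpow_inv_two_re]; positivity
  rw [tInv, ← hsq, ← sqrt_eq_ofReal_iff (abs_nonneg u)]
  set c := Complex.sqrt (2 * alphaC γ (Complex.log z))
  rcases lt_trichotomy z.im 0 with h | h | h
  · rw [Real.sign_of_neg h]
    rcases lt_or_gt_of_ne hu with h' | h'
    · rw [Real.sign_of_neg h', abs_of_neg h']
      push_cast
      simp only [true_and]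
      constructor
      · intro h; linear_combination -h
      · intro h; linear_combination -h
    · rw [Real.sign_of_pos h']
      refine ⟨fun h1 => ?_, fun h1 => absurd h1.1 (by norm_num)⟩
      have := congrArg Complex.re h1
      simp at this
      linarith
  · rw [h, Real.sign_zero]
    simp only [Complex.ofReal_zero, zero_mul]
    refine ⟨fun h1 => absurd h1.symm (by exact_mod_cast hu), fun h1 => absurd h1.1.symm ?_⟩
    exact Real.sign_eq_zero_iff.not.2 hu
  · rw [Real.sign_of_pos h]
    rcases lt_or_gt_of_ne hu with h' | h'
    · rw [Real.sign_of_neg h']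
      refine ⟨fun h1 => ?_, fun h1 => absurd h1.1 (by norm_num)⟩
      have := congrArg Complex.re h1
      simp at this
      linarith
    · rw [Real.sign_of_pos h', abs_of_pos h']
      simp

lemma sign_log_im (z : ℂ) (hz : z.im ≠ 0) : Real.sign (Complex.log z).im = Real.sign z.im := by
  rw [Complex.log_im]
  rcases lt_or_gt_of_ne hz with h | h
  · rw [Real.sign_of_neg h, Real.sign_of_neg (Complex.arg_neg_iff.2 h)]
  · rw [Real.sign_of_pos h, Real.sign_of_pos]
    refine (Complex.arg_nonneg_iff.2 h.le).lt_of_ne fun h0 => ?_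
    rw [eq_comm, Complex.arg_eq_zero_iff] at h0
    exact hz h0.2

lemma log_im_lt_pi (z : ℂ) (hz : z.im ≠ 0) : (Complex.log z).im < Real.pi := by
  rw [Complex.log_im]
  refine (Complex.arg_le_pi z).lt_of_ne fun h => ?_
  rw [Complex.arg_eq_pi_iff] at h
  exact hz h.2

/-- A solution of `α(w) = r` in the strip `|Im w| < π` off the real line is determined by the sign
of its imaginary part. -/
lemma alphaC_injective_of_sign_eq {γ : ℝ} (hγ : 0 < γ) {w₁ w₂ : ℂ} (h₁ : w₁.im ≠ 0)
    (hs : Real.sign w₁.im = Real.sign w₂.im) (h₁' : |w₁.im| < Real.pi) (h₂' : |w₂.im| < Real.pi)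
    {r : ℝ} (ha₁ : alphaC γ w₁ = r) (ha₂ : alphaC γ w₂ = r) : w₁ = w₂ := by
  rw [abs_lt] at h₁' h₂'
  rcases lt_or_gt_of_ne h₁ with h | h
  · have h2 : w₂.im < 0 := by
      rw [Real.sign_of_neg h] at hs
      by_contra! h3
      rcases h3.eq_or_lt with h3 | h3
      · rw [← h3, Real.sign_zero] at hs; norm_num at hs
      · rw [Real.sign_of_pos h3] at hs; norm_num at hs
    have := alphaC_injective_of_im_eq_zero hγ (w₁ := starRingEnd ℂ w₁) (w₂ := starRingEnd ℂ w₂)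
      (by simpa using h) (by simpa using by linarith [h₁'.1]) (by simpa using h2)
      (by simpa using by linarith [h₂'.1]) (r := r) (by rw [alphaC_conj, ha₁]; simp)
      (by rw [alphaC_conj, ha₂]; simp)
    exact (starRingEnd ℂ).injective this
  · have h2 : 0 < w₂.im := by
      rw [Real.sign_of_pos h] at hs
      by_contra! h3
      rcases h3.eq_or_lt with h3 | h3
      · rw [h3, Real.sign_zero] at hs; norm_num at hs
      · rw [Real.sign_of_neg h3] at hs; norm_num at hs
    exact alphaC_injective_of_im_eq_zero hγ h h₁'.2 h2 h₂'.2 ha₁ ha₂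

lemma im_ne_zero_of_tInv_eq {γ u : ℝ} (hu : u ≠ 0) {z : ℂ} (h : tInv γ z = u) : z.im ≠ 0 := by
  have h1 := ((tInv_eq_iff γ hu z).1 h).1
  intro h0
  rw [h0, Real.sign_zero] at h1
  exact hu (Real.sign_eq_zero_iff.1 h1.symm)

lemma abs_log_im_lt_pi (z : ℂ) (hz : z.im ≠ 0) : |(Complex.log z).im| < Real.pi :=
  abs_lt.2 ⟨Complex.neg_pi_lt_log_im z, log_im_lt_pi z hz⟩

lemma exp_im_sign {w : ℂ} (h : w.im ≠ 0) (h' : |w.im| < Real.pi) :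
    Real.sign (Complex.exp w).im = Real.sign w.im := by
  have h0 : (Complex.exp w).im ≠ 0 := by
    rw [Complex.exp_im]
    refine mul_ne_zero (Real.exp_pos _).ne' ?_
    rw [abs_lt] at h'
    exact (Real.sin_eq_zero_iff_of_lt_of_lt h'.1 h'.2).not.2 h
  rw [← sign_log_im _ h0, Complex.log_exp (abs_lt.1 h').1 (abs_lt.1 h').2.le]

lemma tInv_exp_eq_iff (γ : ℝ) {u : ℝ} (hu : u ≠ 0) {w : ℂ} (h : w.im ≠ 0) (h' : |w.im| < Real.pi) :
    tInv γ (Complex.exp w) = u ↔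
      Real.sign w.im = Real.sign u ∧ alphaC γ w = ((u ^ 2 / 2 : ℝ) : ℂ) := by
  rw [tInv_eq_iff γ hu, exp_im_sign h h', Complex.log_exp (abs_lt.1 h').1 (abs_lt.1 h').2.le]

lemma exists_tInv_eq {γ : ℝ} (hγ : 0 < γ) {u : ℝ} (hu : u ≠ 0) : ∃ z : ℂ, tInv γ z = u := by
  obtain ⟨w, h0, h1, h2⟩ := exists_alphaC_eq hγ (r := u ^ 2 / 2) (by positivity)
  rcases lt_or_gt_of_ne hu with h | h
  · refine ⟨Complex.exp (starRingEnd ℂ w),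
      (tInv_exp_eq_iff γ hu (by simpa using h0.ne') ?_).2 ⟨?_, ?_⟩⟩
    · rw [Complex.conj_im, abs_neg, abs_of_pos h0]; exact h1
    · rw [Complex.conj_im, Real.sign_of_neg h, Real.sign_of_neg (by linarith)]
    · rw [alphaC_conj, h2, Complex.conj_ofReal]
  · refine ⟨Complex.exp w, (tInv_exp_eq_iff γ hu h0.ne' ?_).2 ⟨?_, h2⟩⟩
    · rw [abs_of_pos h0]; exact h1
    · rw [Real.sign_of_pos h, Real.sign_of_pos h0]

lemma tInv_injective {γ : ℝ} (hγ : 0 < γ) {u : ℝ} (hu : u ≠ 0) {z₁ z₂ : ℂ}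
    (h₁ : tInv γ z₁ = u) (h₂ : tInv γ z₂ = u) : z₁ = z₂ := by
  have i1 := im_ne_zero_of_tInv_eq hu h₁
  have i2 := im_ne_zero_of_tInv_eq hu h₂
  have e1 := (tInv_eq_iff γ hu z₁).1 h₁
  have e2 := (tInv_eq_iff γ hu z₂).1 h₂
  have l1 : (Complex.log z₁).im ≠ 0 := by
    rw [Ne, ← Real.sign_eq_zero_iff.not, sign_log_im _ i1, Real.sign_eq_zero_iff]; exact i1
  have hlog := alphaC_injective_of_sign_eq hγ l1
    (by rw [sign_log_im _ i1, sign_log_im _ i2, e1.1, e2.1])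
    (abs_log_im_lt_pi _ i1) (abs_log_im_lt_pi _ i2) e1.2 e2.2
  rw [← Complex.exp_log (x := z₁) (by rintro rfl; exact i1 rfl), hlog,
    Complex.exp_log (by rintro rfl; exact i2 rfl)]

lemma existsUnique_tInv_eq {γ : ℝ} (hγ : 0 < γ) {u : ℝ} (hu : u ≠ 0) : ∃! z : ℂ, tInv γ z = u := by
  obtain ⟨z, hz⟩ := exists_tInv_eq hγ hu
  exact ⟨z, hz, fun z' hz' => tInv_injective hγ hu hz' hz⟩

lemma tInv_tfun {γ : ℝ} (hγ : 0 < γ) {u : ℝ} (hu : u ≠ 0) : tInv γ (tfun γ u) = u := by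
  rw [tfun, if_neg hu]
  exact Function.invFun_eq (exists_tInv_eq hγ hu)

/-- The steepest descent path `u ↦ ln t(u)` in the logarithmic plane. -/
noncomputable def descentPath (γ u : ℝ) : ℂ := Complex.log (tfun γ u)

lemma tfun_im_ne_zero {γ : ℝ} (hγ : 0 < γ) {u : ℝ} (hu : u ≠ 0) : (tfun γ u).im ≠ 0 :=
  im_ne_zero_of_tInv_eq hu (tInv_tfun hγ hu)

lemma exp_descentPath {γ : ℝ} (hγ : 0 < γ) {u : ℝ} (hu : u ≠ 0) :
    Complex.exp (descentPath γ u) = tfun γ u :=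
  Complex.exp_log fun h => tfun_im_ne_zero hγ hu (by rw [h]; rfl)

lemma alphaC_descentPath {γ : ℝ} (hγ : 0 < γ) {u : ℝ} (hu : u ≠ 0) :
    alphaC γ (descentPath γ u) = ((u ^ 2 / 2 : ℝ) : ℂ) :=
  ((tInv_eq_iff γ hu _).1 (tInv_tfun hγ hu)).2

lemma sign_descentPath_im {γ : ℝ} (hγ : 0 < γ) {u : ℝ} (hu : u ≠ 0) :
    Real.sign (descentPath γ u).im = Real.sign u := by
  rw [descentPath, sign_log_im _ (tfun_im_ne_zero hγ hu)]
  exact ((tInv_eq_iff γ hu _).1 (tInv_tfun hγ hu)).1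

lemma descentPath_im_ne_zero {γ : ℝ} (hγ : 0 < γ) {u : ℝ} (hu : u ≠ 0) :
    (descentPath γ u).im ≠ 0 := by
  rw [Ne, ← Real.sign_eq_zero_iff.not, sign_descentPath_im hγ hu, Real.sign_eq_zero_iff]
  exact hu

lemma abs_descentPath_im_lt {γ : ℝ} (hγ : 0 < γ) {u : ℝ} (hu : u ≠ 0) :
    |(descentPath γ u).im| < Real.pi :=
  abs_log_im_lt_pi _ (tfun_im_ne_zero hγ hu)

lemma descentPath_eq_of_alphaC_eq {γ : ℝ} (hγ : 0 < γ) {u : ℝ} (hu : u ≠ 0) {w : ℂ}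
    (hs : Real.sign w.im = Real.sign u) (h' : |w.im| < Real.pi)
    (h : alphaC γ w = ((u ^ 2 / 2 : ℝ) : ℂ)) : descentPath γ u = w :=
  alphaC_injective_of_sign_eq hγ (descentPath_im_ne_zero hγ hu)
    (by rw [sign_descentPath_im hγ hu, hs]) (abs_descentPath_im_lt hγ hu) h'
    (alphaC_descentPath hγ hu) h

lemma sinh_sub_sinh_im (γ : ℝ) (w : ℂ) : (Complex.sinh γ - Complex.sinh w).im =
    -(Real.cosh w.re * Real.sin w.im) := by
  have h2 : (Complex.sinh w).im = Real.cosh w.re * Real.sin w.im := by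
    conv_lhs => rw [← Complex.re_add_im w]
    rw [Complex.sinh_add, Complex.cosh_mul_I, Complex.sinh_mul_I, ← Complex.ofReal_sinh,
      ← Complex.ofReal_cosh, ← Complex.ofReal_cos, ← Complex.ofReal_sin]
    simp [-Complex.ofReal_cosh, -Complex.ofReal_sinh, -Complex.ofReal_cos, -Complex.ofReal_sin]
  rw [Complex.sub_im, h2, ← Complex.ofReal_sinh, Complex.ofReal_im, zero_sub]

lemma deriv_alphaC_ne_zero (γ : ℝ) {w : ℂ} (h : w.im ≠ 0) (h' : |w.im| < Real.pi) :
    Complex.sinh γ - Complex.sinh w ≠ 0 := by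
  intro h0
  have h1 := congrArg Complex.im h0
  rw [sinh_sub_sinh_im, Complex.zero_im, neg_eq_zero] at h1
  rw [abs_lt] at h'
  exact mul_ne_zero (Real.cosh_pos _).ne' ((Real.sin_eq_zero_iff_of_lt_of_lt h'.1 h'.2).not.2 h) h1

lemma sign_eq_of_mul_pos {a b : ℝ} (h : 0 < a * b) : Real.sign a = Real.sign b := by
  rcases mul_pos_iff.1 h with ⟨h1, h2⟩ | ⟨h1, h2⟩
  · rw [Real.sign_of_pos h1, Real.sign_of_pos h2]
  · rw [Real.sign_of_neg h1, Real.sign_of_neg h2]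

lemma mul_pos_of_sign_eq {a b : ℝ} (hb : b ≠ 0) (h : Real.sign a = Real.sign b) : 0 < a * b := by
  rcases lt_or_gt_of_ne hb with h1 | h1
  · rw [Real.sign_of_neg h1] at h
    rcases lt_trichotomy a 0 with h2 | h2 | h2
    · exact mul_pos_of_neg_of_neg h2 h1
    · rw [h2, Real.sign_zero] at h; norm_num at h
    · rw [Real.sign_of_pos h2] at h; norm_num at h
  · rw [Real.sign_of_pos h1] at h
    rcases lt_trichotomy a 0 with h2 | h2 | h2
    · rw [Real.sign_of_neg h2] at h; norm_num at h
    · rw [h2, Real.sign_zero] at h; norm_num at h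
    · exact mul_pos h2 h1

/-- The local inverse of `α` provided by the inverse function theorem agrees with the path near `u`,
by uniqueness of the solution. -/
lemma hasDerivAt_descentPath {γ : ℝ} (hγ : 0 < γ) {u : ℝ} (hu : u ≠ 0) :
    HasDerivAt (descentPath γ) (u / (Complex.sinh γ - Complex.sinh (descentPath γ u))) u := by
  set w₀ := descentPath γ u
  have hne := deriv_alphaC_ne_zero γ (descentPath_im_ne_zero hγ hu) (abs_descentPath_im_lt hγ hu)
  have hf := hasStrictDerivAt_alphaC γ w₀
  set li := hf.localInverse _ _ _ hne
  have hα : alphaC γ w₀ = ((u ^ 2 / 2 : ℝ) : ℂ) := alphaC_descentPath hγ hu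
  have hli0 : li (alphaC γ w₀) = w₀ :=
    (hf.hasStrictFDerivAt_equiv hne).localInverse_apply_image
  have hright : ∀ᶠ y in 𝓝 (alphaC γ w₀), alphaC γ (li y) = y :=
    (hf.hasStrictFDerivAt_equiv hne).eventually_right_inverse
  have hd : HasDerivAt li (Complex.sinh γ - Complex.sinh w₀)⁻¹ (alphaC γ w₀) :=
    (hf.to_localInverse hne).hasDerivAt
  have hsq : HasDerivAt (fun v : ℝ => ((v ^ 2 / 2 : ℝ) : ℂ)) (u : ℂ) u := by
    have : HasDerivAt (fun v : ℝ => v ^ 2 / 2) u u := by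
      convert! (hasDerivAt_pow 2 u).div_const 2 using 1
      simp
    exact this.ofReal_comp
  rw [hα] at hd hli0 hright
  have hcomp := HasDerivAt.scomp u hd hsq
  have hev : descentPath γ =ᶠ[𝓝 u] li ∘ fun v : ℝ => ((v ^ 2 / 2 : ℝ) : ℂ) := by
    have hcont := hcomp.continuousAt
    have h0 : (li ∘ fun v : ℝ => ((v ^ 2 / 2 : ℝ) : ℂ)) u = w₀ := hli0
    have him : ContinuousAt (fun v => ((li ∘ fun v : ℝ => ((v ^ 2 / 2 : ℝ) : ℂ)) v).im) u :=
      Complex.continuous_im.continuousAt.comp hcont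
    have e1 := (him.mul continuousAt_id).eventually (lt_mem_nhds (a := 0) (by
      show 0 < ((li ∘ fun v : ℝ => ((v ^ 2 / 2 : ℝ) : ℂ)) u).im * u
      rw [h0]
      exact mul_pos_of_sign_eq hu (sign_descentPath_im hγ hu)))
    have h0' : |((li ∘ fun v : ℝ => ((v ^ 2 / 2 : ℝ) : ℂ)) u).im| < Real.pi := by
      rw [h0]; exact abs_descentPath_im_lt hγ hu
    have e2 := him.abs.eventually (gt_mem_nhds h0')
    filter_upwards [e1, e2, hsq.continuousAt.eventually hright, isOpen_ne.mem_nhds hu]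
      with v h1 h2 h3 h4
    exact descentPath_eq_of_alphaC_eq hγ h4 (sign_eq_of_mul_pos h1) h2 h3
  convert! hcomp.congr_of_eventuallyEq hev using 1

lemma hasDerivAt_tfun {γ : ℝ} (hγ : 0 < γ) {u : ℝ} (hu : u ≠ 0) :
    HasDerivAt (tfun γ) (Complex.exp (descentPath γ u) *
      (u / (Complex.sinh γ - Complex.sinh (descentPath γ u)))) u := by
  have h := (hasDerivAt_descentPath hγ hu).cexp
  refine h.congr_of_eventuallyEq ?_
  filter_upwards [isOpen_ne.mem_nhds hu] with v hv
  exact (exp_descentPath hγ hv).symm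

/-! ### Limits and weighted length of the steepest descent path -/

lemma descentPath_im_pos {γ : ℝ} (hγ : 0 < γ) {u : ℝ} (hu : 0 < u) : 0 < (descentPath γ u).im := by
  have := mul_pos_of_sign_eq hu.ne' (sign_descentPath_im hγ hu.ne')
  exact pos_of_mul_pos_left this hu.le

lemma descentPath_im_lt_pi {γ : ℝ} (hγ : 0 < γ) {u : ℝ} (hu : 0 < u) :
    (descentPath γ u).im < Real.pi :=
  (abs_lt.1 (abs_descentPath_im_lt hγ hu.ne')).2

lemma sinh_mul_sin_descentPath {γ : ℝ} (hγ : 0 < γ) {u : ℝ} (hu : 0 < u) :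
    Real.sinh (descentPath γ u).re * Real.sin (descentPath γ u).im =
      Real.sinh γ * (descentPath γ u).im := by
  have h := congrArg Complex.im (alphaC_descentPath hγ hu.ne')
  rw [alphaC_im, Complex.ofReal_im] at h
  linarith

lemma alpha_re_descentPath {γ : ℝ} (hγ : 0 < γ) {u : ℝ} (hu : 0 < u) :
    Real.cosh γ - Real.cosh (descentPath γ u).re * Real.cos (descentPath γ u).im +
      Real.sinh γ * ((descentPath γ u).re - γ) = u ^ 2 / 2 := by
  have h := congrArg Complex.re (alphaC_descentPath hγ hu.ne')
  rwa [alphaC_re, Complex.ofReal_re] at h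

lemma lt_descentPath_re {γ : ℝ} (hγ : 0 < γ) {u : ℝ} (hu : 0 < u) : γ < (descentPath γ u).re :=
  lt_re_of_alphaC_im_eq_zero hγ (descentPath_im_pos hγ hu) (descentPath_im_lt_pi hγ hu)
    (by rw [alphaC_descentPath hγ hu.ne', Complex.ofReal_im])

/-- Since `sinh a = sinh γ · b / sin b`, this is `b cos b ≤ sin b`. -/
lemma sinh_mul_cos_descentPath_le {γ : ℝ} (hγ : 0 < γ) {u : ℝ} (hu : 0 < u) :
    Real.sinh (descentPath γ u).re * Real.cos (descentPath γ u).im ≤ Real.sinh γ := by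
  have hsγ : 0 < Real.sinh γ := Real.sinh_pos_iff.2 hγ
  have hb := descentPath_im_pos hγ hu
  have hb' := descentPath_im_lt_pi hγ hu
  have ha : 0 < Real.sinh (descentPath γ u).re :=
    Real.sinh_pos_iff.2 (hγ.trans (lt_descentPath_re hγ hu))
  have hsin := Real.sin_pos_of_pos_of_lt_pi hb hb'
  rcases le_or_gt (Real.cos (descentPath γ u).im) 0 with hc | hc
  · nlinarith
  · have h1 := mul_le_mul_of_nonneg_left (mul_cos_le_sin hb hb') hsγ.le
    have h2 := sinh_mul_sin_descentPath hγ hu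
    refine le_of_mul_le_mul_right ?_ hsin
    calc _ = Real.sinh (descentPath γ u).re * Real.sin (descentPath γ u).im *
          Real.cos (descentPath γ u).im := by ring
      _ = Real.sinh γ * ((descentPath γ u).im * Real.cos (descentPath γ u).im) := by rw [h2]; ring
      _ ≤ _ := h1

/-- In the plane of `z = e^w` the steepest descent path stays in the half plane
`Re z ≤ e^γ`. -/
lemma exp_mul_cos_descentPath_le {γ : ℝ} (hγ : 0 < γ) {u : ℝ} (hu : 0 < u) :
    Real.exp (descentPath γ u).re * Real.cos (descentPath γ u).im ≤ Real.exp γ := by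
  have h1 := sinh_mul_cos_descentPath_le hγ hu
  have h2 := (lt_descentPath_re hγ hu).le
  rw [Real.sinh_eq, Real.sinh_eq] at h1
  have h3 : Real.exp (-(descentPath γ u).re) * Real.cos (descentPath γ u).im ≤ Real.exp (-γ) := by
    calc _ ≤ Real.exp (-(descentPath γ u).re) * 1 := by gcongr; exact Real.cos_le_one _
      _ ≤ _ := by rw [mul_one]; gcongr
  linarith

lemma tendsto_descentPath_nhdsWithin_zero {γ : ℝ} (hγ : 0 < γ) :
    Tendsto (descentPath γ) (𝓝[>] 0) (𝓝 (γ : ℂ)) := by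
  have hcγ := Real.cosh_pos γ
  -- `u² / 2 ≥ cosh γ (1 - cos b)` forces `b → 0`; then `sinh a = sinh γ · b / sin b → sinh γ`.
  have hb : Tendsto (fun u => (descentPath γ u).im) (𝓝[>] 0) (𝓝 0) := by
    have hbd : Tendsto (fun u : ℝ => √(Real.pi ^ 2 * u ^ 2 / (4 * Real.cosh γ)))
        (𝓝[>] 0) (𝓝 0) := by
      have : Continuous (fun u : ℝ => √(Real.pi ^ 2 * u ^ 2 / (4 * Real.cosh γ))) := by fun_prop
      have h := (this.tendsto 0).mono_left (nhdsWithin_le_nhds (s := Ioi 0))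
      simpa using h
    refine tendsto_of_tendsto_of_tendsto_of_le_of_le' tendsto_const_nhds hbd ?_ ?_
    · filter_upwards [self_mem_nhdsWithin] with u hu using (descentPath_im_pos hγ hu).le
    · filter_upwards [self_mem_nhdsWithin] with u hu
      have hb := descentPath_im_pos hγ hu
      have hb' := descentPath_im_lt_pi hγ hu
      have h1 := alpha_re_mono hγ hb hb' hγ.le (lt_descentPath_re hγ hu).le
        (sinh_mul_sin_descentPath hγ hu).le
      rw [alpha_re_descentPath hγ hu] at h1
      have h2 := Real.cos_le_one_sub_mul_cos_sq (x := (descentPath γ u).im)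
        (by rw [abs_of_pos hb]; exact hb'.le)
      have h3 := mul_le_mul_of_nonneg_left h2 hcγ.le
      refine Real.le_sqrt_of_sq_le ?_
      rw [le_div_iff₀ (by positivity)]
      have h4 : Real.cosh γ * (2 / Real.pi ^ 2 * (descentPath γ u).im ^ 2) ≤ u ^ 2 / 2 := by
        linarith
      calc (descentPath γ u).im ^ 2 * (4 * Real.cosh γ) = 2 * Real.pi ^ 2 *
            (Real.cosh γ * (2 / Real.pi ^ 2 * (descentPath γ u).im ^ 2)) := by
              have := Real.pi_pos
              field_simp; ring
        _ ≤ 2 * Real.pi ^ 2 * (u ^ 2 / 2) := by gcongr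
        _ = _ := by ring
  have ha : Tendsto (fun u => (descentPath γ u).re) (𝓝[>] 0) (𝓝 γ) := by
    have hc : ContinuousAt (fun b => Real.arsinh (Real.sinh γ / Real.sinc b)) 0 :=
      Real.continuous_arsinh.continuousAt.comp
        (continuousAt_const.div Real.continuous_sinc.continuousAt (by simp))
    have h := hc.tendsto.comp hb
    simp only [Real.sinc_zero, div_one, Real.arsinh_sinh] at h
    refine h.congr' ?_
    filter_upwards [self_mem_nhdsWithin] with u hu
    have hb := descentPath_im_pos hγ hu
    have hsin := Real.sin_pos_of_pos_of_lt_pi hb (descentPath_im_lt_pi hγ hu)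
    simp only [Function.comp_apply]
    rw [Real.sinc_of_ne_zero hb.ne', div_div_eq_mul_div, ← sinh_mul_sin_descentPath hγ hu,
      mul_div_cancel_right₀ _ hsin.ne', Real.arsinh_sinh]
  have h := (Complex.continuous_ofReal.tendsto γ).comp ha |>.add
    (((Complex.continuous_ofReal.tendsto 0).comp hb).mul_const Complex.I)
  simp only [Function.comp_def, Complex.re_add_im] at h
  simpa using h

lemma tendsto_descentPath_re_atTop {γ : ℝ} (hγ : 0 < γ) :
    Tendsto (fun u => (descentPath γ u).re) atTop atTop := by
  have hsγ : 0 < Real.sinh γ := Real.sinh_pos_iff.2 hγ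
  refine tendsto_atTop.2 fun M => ?_
  set B := Real.cosh γ + Real.cosh M + Real.sinh γ * M with hB
  filter_upwards [eventually_gt_atTop 0, eventually_gt_atTop (1 + 2 * |B|)] with u hu hu2
  by_contra! hlt
  have ha := (lt_descentPath_re hγ hu)
  have h1 := alpha_re_descentPath hγ hu
  have h2 : Real.cosh (descentPath γ u).re ≤ Real.cosh M := by
    rw [Real.cosh_le_cosh, abs_of_pos (hγ.trans ha), abs_of_pos (by linarith)]; exact hlt.le
  have h3 := Real.neg_one_le_cos (descentPath γ u).im
  have h4 := mul_le_mul_of_nonneg_left h3 (Real.cosh_pos (descentPath γ u).re).le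
  have h5 := mul_le_mul_of_nonneg_left hlt.le hsγ.le
  have h6 := mul_pos hsγ hγ
  have h7 : u ^ 2 / 2 ≤ B := by rw [hB]; linarith
  have h8 := le_abs_self B
  nlinarith [abs_nonneg B]

/-- The velocity `dw/du` of the steepest descent path. -/
noncomputable def descentVelocity (γ u : ℝ) : ℂ :=
  u / (Complex.sinh γ - Complex.sinh (descentPath γ u))

lemma sinh_sub_sinh_re (γ : ℝ) (w : ℂ) : (Complex.sinh γ - Complex.sinh w).re =
    Real.sinh γ - Real.sinh w.re * Real.cos w.im := by
  have h2 : (Complex.sinh w).re = Real.sinh w.re * Real.cos w.im := by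
    conv_lhs => rw [← Complex.re_add_im w]
    rw [Complex.sinh_add, Complex.cosh_mul_I, Complex.sinh_mul_I, ← Complex.ofReal_sinh,
      ← Complex.ofReal_cosh, ← Complex.ofReal_cos, ← Complex.ofReal_sin]
    simp [-Complex.ofReal_cosh, -Complex.ofReal_sinh, -Complex.ofReal_cos, -Complex.ofReal_sin]
  rw [Complex.sub_re, h2, ← Complex.ofReal_sinh, Complex.ofReal_re]

lemma descentVelocity_re_nonneg {γ : ℝ} (hγ : 0 < γ) {u : ℝ} (hu : 0 < u) :
    0 ≤ (descentVelocity γ u).re := by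
  have h : 0 ≤ (Complex.sinh γ - Complex.sinh (descentPath γ u)).re := by
    rw [sinh_sub_sinh_re, sub_nonneg]; exact sinh_mul_cos_descentPath_le hγ hu
  rw [descentVelocity, Complex.div_re, Complex.ofReal_re, Complex.ofReal_im, zero_mul, zero_div,
    add_zero]
  exact div_nonneg (mul_nonneg hu.le h) (Complex.normSq_nonneg _)

lemma descentVelocity_im_nonneg {γ : ℝ} (hγ : 0 < γ) {u : ℝ} (hu : 0 < u) :
    0 ≤ (descentVelocity γ u).im := by
  have h : (Complex.sinh γ - Complex.sinh (descentPath γ u)).im ≤ 0 := by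
    rw [sinh_sub_sinh_im, neg_nonpos]
    exact mul_nonneg (Real.cosh_pos _).le
      (Real.sin_nonneg_of_nonneg_of_le_pi (descentPath_im_pos hγ hu).le
        (descentPath_im_lt_pi hγ hu).le)
  rw [descentVelocity, Complex.div_im, Complex.ofReal_re, Complex.ofReal_im, zero_mul, zero_div,
    zero_sub, neg_nonneg]
  exact div_nonpos_of_nonpos_of_nonneg (mul_nonpos_of_nonneg_of_nonpos hu.le h)
    (Complex.normSq_nonneg _)

lemma hasDerivAt_descentPath_re {γ : ℝ} (hγ : 0 < γ) {u : ℝ} (hu : 0 < u) :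
    HasDerivAt (fun v => (descentPath γ v).re) (descentVelocity γ u).re u :=
  Complex.reCLM.hasFDerivAt.comp_hasDerivAt u (hasDerivAt_descentPath hγ hu.ne')

lemma hasDerivAt_descentPath_im {γ : ℝ} (hγ : 0 < γ) {u : ℝ} (hu : 0 < u) :
    HasDerivAt (fun v => (descentPath γ v).im) (descentVelocity γ u).im u :=
  Complex.imCLM.hasFDerivAt.comp_hasDerivAt u (hasDerivAt_descentPath hγ hu.ne')

lemma descentPath_zero (γ : ℝ) : descentPath γ 0 = γ := by
  rw [descentPath, tfun, if_pos rfl, Complex.ofReal_exp, ← Complex.ofReal_exp, ← Complex.ofReal_log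
    (Real.exp_pos γ).le, Real.log_exp]

lemma continuousWithinAt_descentPath_zero {γ : ℝ} (hγ : 0 < γ) :
    ContinuousWithinAt (descentPath γ) (Ici 0) 0 := by
  rw [← continuousWithinAt_Ioi_iff_Ici, ContinuousWithinAt, descentPath_zero]
  exact tendsto_descentPath_nhdsWithin_zero hγ

lemma integrableOn_descentVelocity_im {γ : ℝ} (hγ : 0 < γ) :
    IntegrableOn (fun u => (descentVelocity γ u).im) (Ioi 0) := by
  have hc : ContinuousWithinAt (fun u => (descentPath γ u).im) (Ici 0) 0 :=
    Complex.continuous_im.continuousAt.comp_continuousWithinAt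
      (continuousWithinAt_descentPath_zero hγ)
  -- The imaginary part is monotone and bounded, so it has a limit and its derivative is integrable.
  have hmono : MonotoneOn (fun u => (descentPath γ u).im) (Ici 0) := by
    refine monotoneOn_of_hasDerivWithinAt_nonneg (f' := fun u => (descentVelocity γ u).im)
      (convex_Ici 0) ?_ ?_ ?_
    · intro u hu
      rcases (mem_Ici.1 hu).eq_or_lt with h | h
      · rw [← h]; exact hc
      · exact (hasDerivAt_descentPath_im hγ h).continuousAt.continuousWithinAt
    · intro u hu
      rw [interior_Ici] at hu
      exact (hasDerivAt_descentPath_im hγ hu).hasDerivWithinAt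
    · intro u hu
      rw [interior_Ici] at hu
      exact descentVelocity_im_nonneg hγ hu
  have hm : Monotone (fun u => (descentPath γ (max u 0)).im) := fun u v h =>
    hmono (le_max_right u 0) (le_max_right v 0) (max_le_max_right 0 h)
  have hbdd : BddAbove (range fun u => (descentPath γ (max u 0)).im) := by
    refine ⟨Real.pi, ?_⟩
    rintro _ ⟨u, rfl⟩
    rcases (le_max_right u 0).eq_or_lt with h | h
    · simp only [← h, descentPath_zero, Complex.ofReal_im]; exact Real.pi_pos.le
    · exact (descentPath_im_lt_pi hγ h).le
  have hlim := tendsto_atTop_ciSup hm hbdd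
  refine integrableOn_Ioi_deriv_of_nonneg hc (fun u hu => hasDerivAt_descentPath_im hγ hu)
    (fun u hu => descentVelocity_im_nonneg hγ hu) (hlim.congr' ?_)
  filter_upwards [eventually_ge_atTop 0] with u hu
  rw [max_eq_left hu]

lemma integrableOn_descentVelocity_re_mul_exp {γ κ : ℝ} (hγ : 0 < γ) (hκ : 0 < κ) :
    IntegrableOn (fun u => (descentVelocity γ u).re * Real.exp (-κ * (descentPath γ u).re))
      (Ioi 0) := by
  have hre : ContinuousWithinAt (fun u => (descentPath γ u).re) (Ici 0) 0 :=
    Complex.continuous_re.continuousAt.comp_continuousWithinAt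
      (continuousWithinAt_descentPath_zero hγ)
  have hint : IntegrableOn
      (fun u => κ * ((descentVelocity γ u).re * Real.exp (-κ * (descentPath γ u).re))) (Ioi 0) := by
    refine integrableOn_Ioi_deriv_of_nonneg (l := 0)
      (g := fun u => -Real.exp (-κ * (descentPath γ u).re)) ?_ ?_ ?_ ?_
    · exact (Real.continuous_exp.continuousAt.comp_continuousWithinAt (hre.const_mul (-κ))).neg
    · intro u hu
      convert! (((hasDerivAt_descentPath_re hγ hu).const_mul (-κ)).exp).neg using 1
      ring
    · intro u hu
      have := descentVelocity_re_nonneg hγ hu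
      positivity
    · rw [← neg_zero]
      refine (Real.tendsto_exp_atBot.comp ?_).neg
      exact (tendsto_descentPath_re_atTop hγ).const_mul_atTop_of_neg (neg_lt_zero.2 hκ)
  refine (hint.const_mul κ⁻¹).congr (Eventually.of_forall fun u => ?_)
  simp only []
  rw [← mul_assoc, inv_mul_cancel₀ hκ.ne', one_mul]

lemma continuousOn_descentPath {γ : ℝ} (hγ : 0 < γ) : ContinuousOn (descentPath γ) (Ioi 0) :=
  fun _ hu => (hasDerivAt_descentPath hγ (ne_of_gt hu)).continuousAt.continuousWithinAt

lemma continuousOn_descentVelocity {γ : ℝ} (hγ : 0 < γ) :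
    ContinuousOn (descentVelocity γ) (Ioi 0) := by
  refine ContinuousOn.div Complex.continuous_ofReal.continuousOn
    (continuousOn_const.sub (Complex.continuous_sinh.comp_continuousOn
      (continuousOn_descentPath hγ))) fun u hu => ?_
  exact deriv_alphaC_ne_zero γ (descentPath_im_ne_zero hγ (ne_of_gt hu))
    (abs_descentPath_im_lt hγ (ne_of_gt hu))

/-- Along the path the real part increases to `∞` while `e^{-c u²}` decays at least like a power of
`e^{-Re w}`, and the imaginary part increases but stays below `π`; so the path has finite weighted
length. -/
lemma integrableOn_descentVelocity_mul_exp {γ c : ℝ} (hγ : 0 < γ) (hc : 0 < c) :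
    IntegrableOn (fun u => descentVelocity γ u * Real.exp (-c * u ^ 2)) (Ioi 0) := by
  have hsγ : 0 < Real.sinh γ := Real.sinh_pos_iff.2 hγ
  set κ := 2 * c * Real.sinh γ with hκ
  set C := Real.exp (2 * c * (Real.exp γ + Real.sinh γ * γ)) with hC
  have hint := (integrableOn_descentVelocity_im hγ).add
    ((integrableOn_descentVelocity_re_mul_exp (κ := κ) hγ (by positivity)).const_mul C)
  refine Integrable.mono' hint ?_ ?_
  · refine ContinuousOn.aestronglyMeasurable ?_ measurableSet_Ioi
    exact (continuousOn_descentVelocity hγ).mul (by fun_prop)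
  · filter_upwards [ae_restrict_mem measurableSet_Ioi] with u hu
    have h1 := descentVelocity_re_nonneg hγ hu
    have h2 := descentVelocity_im_nonneg hγ hu
    have h3 : ‖descentVelocity γ u‖ ≤ (descentVelocity γ u).re + (descentVelocity γ u).im := by
      have := Complex.norm_le_abs_re_add_abs_im (descentVelocity γ u)
      rwa [abs_of_nonneg h1, abs_of_nonneg h2] at this
    have h4 : Real.exp (-c * u ^ 2) ≤ 1 := by
      rw [Real.exp_le_one_iff]; nlinarith [sq_nonneg u]
    have h5 : Real.exp (-c * u ^ 2) ≤ C * Real.exp (-κ * (descentPath γ u).re) := by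
      rw [hC, ← Real.exp_add, Real.exp_le_exp]
      have h6 := alpha_re_descentPath hγ hu
      have h7 : Real.cosh (descentPath γ u).re * Real.cos (descentPath γ u).im ≤ Real.exp γ := by
        have ha := hγ.trans (lt_descentPath_re hγ hu)
        rcases le_or_gt (Real.cos (descentPath γ u).im) 0 with hcos | hcos
        · have := mul_nonpos_of_nonneg_of_nonpos (Real.cosh_pos (descentPath γ u).re).le hcos
          linarith [Real.exp_pos γ]
        · refine le_trans ?_ (exp_mul_cos_descentPath_le hγ hu)
          refine mul_le_mul_of_nonneg_right ?_ hcos.le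
          rw [← Real.cosh_add_sinh]
          linarith [Real.sinh_pos_iff.2 ha]
      have h8 := Real.cosh_pos γ
      have h9 : Real.sinh γ * (descentPath γ u).re - (Real.exp γ + Real.sinh γ * γ) ≤
          u ^ 2 / 2 := by
        linarith
      have h10 := mul_le_mul_of_nonneg_left h9 (by positivity : (0 : ℝ) ≤ 2 * c)
      rw [hκ]
      linarith
    rw [norm_mul, Complex.norm_real, Real.norm_eq_abs, Real.abs_exp]
    calc ‖descentVelocity γ u‖ * Real.exp (-c * u ^ 2)
        ≤ ((descentVelocity γ u).re + (descentVelocity γ u).im) * Real.exp (-c * u ^ 2) := by gcongr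
      _ = (descentVelocity γ u).im * Real.exp (-c * u ^ 2) +
          (descentVelocity γ u).re * Real.exp (-c * u ^ 2) := by ring
      _ ≤ (descentVelocity γ u).im * 1 +
          (descentVelocity γ u).re * (C * Real.exp (-κ * (descentPath γ u).re)) := by gcongr
      _ = _ := by simp only [Pi.add_apply]; ring

/-! ### Contour deformation -/

/-- The horizontal strip `0 < Im w < π`. -/
def upperStrip : Set ℂ := {w | 0 < w.im ∧ w.im < Real.pi}

lemma isOpen_upperStrip : IsOpen upperStrip :=
  (isOpen_lt continuous_const Complex.continuous_im).inter
    (isOpen_lt Complex.continuous_im continuous_const)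

lemma convex_upperStrip : Convex ℝ upperStrip :=
  (convex_halfSpace_im_gt 0).inter (convex_halfSpace_im_lt Real.pi)

/-- A holomorphic function on the strip has a primitive: the conformal map
`w ↦ (e^w - i) / (e^w + i)` onto the unit disc reduces this to the case of a disc. -/
lemma exists_primitive_upperStrip {f : ℂ → ℂ} (hf : DifferentiableOn ℂ f upperStrip) :
    ∃ K : ℂ → ℂ, ∀ w ∈ upperStrip, HasDerivAt K (f w) w := by
  set Z : ℂ → ℂ := fun ζ => Complex.I * (1 + ζ) / (1 - ζ) with hZ
  have hsub : ∀ ζ ∈ Metric.ball (0 : ℂ) 1, 1 - ζ ≠ 0 := by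
    intro ζ hζ h
    rw [mem_ball_zero_iff, ← sub_eq_zero.1 h, norm_one] at hζ
    exact lt_irrefl _ hζ
  have hZim : ∀ ζ ∈ Metric.ball (0 : ℂ) 1, 0 < (Z ζ).im := by
    intro ζ hζ
    have h0 := hsub ζ hζ
    have h1 : (Z ζ).im = (1 - Complex.normSq ζ) / Complex.normSq (1 - ζ) := by
      simp only [hZ, Complex.div_im, Complex.mul_im, Complex.mul_re, Complex.I_re, Complex.I_im,
        Complex.add_re, Complex.add_im, Complex.sub_re, Complex.sub_im, Complex.one_re,
        Complex.one_im, Complex.normSq_apply]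
      ring
    rw [h1]
    refine div_pos ?_ (Complex.normSq_pos.2 h0)
    rw [mem_ball_zero_iff] at hζ
    rw [Complex.normSq_eq_norm_sq, sub_pos]
    exact pow_lt_one₀ (norm_nonneg _) hζ two_ne_zero
  have hZd : ∀ ζ ∈ Metric.ball (0 : ℂ) 1, HasDerivAt Z (2 * Complex.I / (1 - ζ) ^ 2) ζ := by
    intro ζ hζ
    have h0 := hsub ζ hζ
    convert! (((hasDerivAt_id ζ).const_add 1).const_mul Complex.I).div
      ((hasDerivAt_id ζ).const_sub 1) h0 using 1
    simp only [id]
    ring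
  have hlogmem : ∀ ζ ∈ Metric.ball (0 : ℂ) 1, Complex.log (Z ζ) ∈ upperStrip := by
    intro ζ hζ
    have h := hZim ζ hζ
    have hs := sign_log_im (Z ζ) h.ne'
    refine ⟨?_, log_im_lt_pi _ h.ne'⟩
    have := mul_pos_of_sign_eq h.ne' hs
    exact pos_of_mul_pos_left this h.le
  have hG : DifferentiableOn ℂ
      (fun ζ => f (Complex.log (Z ζ)) * (2 * Complex.I / (1 - ζ) ^ 2 / Z ζ))
      (Metric.ball 0 1) := by
    intro ζ hζ
    have h0 := hsub ζ hζ
    have hZ0 : Z ζ ≠ 0 := fun h => by have := hZim ζ hζ; rw [h] at this; exact lt_irrefl _ this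
    have hlog : DifferentiableAt ℂ (fun ζ => Complex.log (Z ζ)) ζ :=
      ((hZd ζ hζ).clog (Complex.mem_slitPlane_iff.2 (Or.inr (hZim ζ hζ).ne'))).differentiableAt
    have hfd : DifferentiableAt ℂ f (Complex.log (Z ζ)) :=
      hf.differentiableAt (isOpen_upperStrip.mem_nhds (hlogmem ζ hζ))
    have h1 : DifferentiableAt ℂ (fun ζ => f (Complex.log (Z ζ))) ζ :=
      DifferentiableAt.comp ζ hfd hlog
    have h2 : DifferentiableAt ℂ (fun ζ : ℂ => (1 - ζ) ^ 2) ζ := by fun_prop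
    have h3 : DifferentiableAt ℂ (fun ζ : ℂ => 2 * Complex.I / (1 - ζ) ^ 2) ζ :=
      (differentiableAt_const _).div h2 (pow_ne_zero 2 h0)
    have h4 : DifferentiableAt ℂ (fun ζ : ℂ => 2 * Complex.I / (1 - ζ) ^ 2 / Z ζ) ζ :=
      h3.div (hZd ζ hζ).differentiableAt hZ0
    exact (h1.mul h4).differentiableWithinAt
  obtain ⟨k, hk⟩ := hG.isExactOn_ball
  refine ⟨fun w => k ((Complex.exp w - Complex.I) / (Complex.exp w + Complex.I)), fun w hw => ?_⟩
  have him : 0 < (Complex.exp w).im := by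
    rw [Complex.exp_im]
    exact mul_pos (Real.exp_pos _) (Real.sin_pos_of_pos_of_lt_pi hw.1 hw.2)
  have hne : Complex.exp w + Complex.I ≠ 0 := by
    intro h
    have := congrArg Complex.im h
    rw [Complex.add_im, Complex.I_im, Complex.zero_im] at this
    linarith
  have hball : (Complex.exp w - Complex.I) / (Complex.exp w + Complex.I) ∈
      Metric.ball (0 : ℂ) 1 := by
    rw [mem_ball_zero_iff, norm_div, div_lt_one (norm_pos_iff.2 hne), ← sq_lt_sq₀ (norm_nonneg _)
      (norm_nonneg _), ← Complex.normSq_eq_norm_sq, ← Complex.normSq_eq_norm_sq,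
      Complex.normSq_apply, Complex.normSq_apply]
    simp only [Complex.sub_re, Complex.sub_im, Complex.add_re, Complex.add_im, Complex.I_re,
      Complex.I_im]
    nlinarith
  have hZw : Z ((Complex.exp w - Complex.I) / (Complex.exp w + Complex.I)) = Complex.exp w := by
    have h1 := hsub _ hball
    have h2 : (1 : ℂ) - (Complex.exp w - Complex.I) / (Complex.exp w + Complex.I) =
        2 * Complex.I / (Complex.exp w + Complex.I) := by field_simp; ring
    simp only [hZ]
    rw [h2]
    field_simp
    ring
  have hd := hk _ hball
  simp only [hZw] at hd
  rw [Complex.log_exp (by linarith [hw.1, Real.pi_pos]) hw.2.le] at hd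
  have hinner : HasDerivAt
      (fun w => (Complex.exp w - Complex.I) / (Complex.exp w + Complex.I))
      (2 * Complex.I * Complex.exp w / (Complex.exp w + Complex.I) ^ 2) w := by
    convert! ((Complex.hasDerivAt_exp w).sub_const Complex.I).div
      ((Complex.hasDerivAt_exp w).add_const Complex.I) hne using 1
    ring
  convert! hd.comp w hinner using 1
  have h2 : (1 : ℂ) - (Complex.exp w - Complex.I) / (Complex.exp w + Complex.I) =
      2 * Complex.I / (Complex.exp w + Complex.I) := by field_simp; ring
  rw [h2]
  have hexp := Complex.exp_ne_zero w
  field_simp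

lemma integral_Ioi_of_hasDerivAt_of_tendsto_of_tendsto {f f' : ℝ → ℂ} {l₀ l₁ : ℂ}
    (hderiv : ∀ u ∈ Ioi (0 : ℝ), HasDerivAt f (f' u) u) (hint : IntegrableOn f' (Ioi 0))
    (h₀ : Tendsto f (𝓝[>] 0) (𝓝 l₀)) (h₁ : Tendsto f atTop (𝓝 l₁)) :
    ∫ u in Ioi (0 : ℝ), f' u = l₁ - l₀ := by
  have hev : ∀ u ∈ Ioi (0 : ℝ), Function.update f 0 l₀ =ᶠ[𝓝 u] f := fun u hu => by
    filter_upwards [isOpen_ne.mem_nhds (ne_of_gt hu)] with v hv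
    exact Function.update_of_ne hv _ _
  have h := integral_Ioi_of_hasDerivAt_of_tendsto (f := Function.update f 0 l₀) (a := 0) (m := l₁)
    ?_ (fun u hu => (hderiv u hu).congr_of_eventuallyEq (hev u hu)) hint ?_
  · rw [h, Function.update_self]
  · rw [← continuousWithinAt_Ioi_iff_Ici, ContinuousWithinAt, Function.update_self]
    refine h₀.congr' ?_
    filter_upwards [self_mem_nhdsWithin] with u hu
    exact (Function.update_of_ne (ne_of_gt hu) _ _).symm
  · refine h₁.congr' ?_
    filter_upwards [eventually_gt_atTop 0] with u hu
    exact (Function.update_of_ne (ne_of_gt hu) _ _).symm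

/-- The integrand of the contour integral, in the variable `w = ln z`. -/
noncomputable def logKernel (k γ θ : ℝ) (w : ℂ) : ℂ :=
  Complex.exp (-k * alphaC γ w) * (Complex.exp w / (Complex.exp w - Real.exp θ))

/-- The part of the half plane `Re z ≤ e^γ` outside the open disc `|z| < e^γ`, in the variable
`w = ln z`. It contains both the vertical line and the steepest descent path. -/
def descentRegion (γ : ℝ) : Set ℂ :=
  {w | γ ≤ w.re ∧ Real.exp w.re * Real.cos w.im ≤ Real.exp γ}

/-- A bound for the integrand on `descentRegion`. -/
noncomputable def kernelBound (k γ θ : ℝ) : ℝ :=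
  Real.exp (k * (Real.exp γ + Real.sinh γ * γ)) *
    (1 + Real.exp θ / |Real.exp γ - Real.exp θ|)

lemma kernelBound_nonneg (k γ θ : ℝ) : 0 ≤ kernelBound k γ θ := by
  unfold kernelBound; positivity

/-- The pole `e^θ` stays at a positive distance: it is to the right of the half plane `Re z ≤ e^γ`
if `γ < θ` and inside the disc `|z| < e^γ` if `θ < γ`. -/
lemma abs_exp_sub_exp_le_norm {γ θ : ℝ} {w : ℂ} (hw : w ∈ descentRegion γ) :
    |Real.exp γ - Real.exp θ| ≤ ‖Complex.exp w - Real.exp θ‖ := by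
  rcases le_total γ θ with h | h
  · rw [abs_of_nonpos (sub_nonpos.2 (Real.exp_le_exp.2 h))]
    have h1 := Complex.abs_re_le_norm (Complex.exp w - Real.exp θ)
    rw [Complex.sub_re, Complex.exp_re, Complex.ofReal_re] at h1
    have h2 := neg_abs_le (Real.exp w.re * Real.cos w.im - Real.exp θ)
    linarith [hw.2]
  · rw [abs_of_nonneg (sub_nonneg.2 (Real.exp_le_exp.2 h))]
    have h1 := norm_sub_norm_le (Complex.exp w) (Real.exp θ : ℂ)
    rw [Complex.norm_exp, Complex.norm_real, Real.norm_eq_abs, Real.abs_exp] at h1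
    have := Real.exp_le_exp.2 hw.1
    linarith

lemma norm_exp_div_le {γ θ : ℝ} (hθ : γ ≠ θ) {w : ℂ} (hw : w ∈ descentRegion γ) :
    ‖Complex.exp w / (Complex.exp w - Real.exp θ)‖ ≤
      1 + Real.exp θ / |Real.exp γ - Real.exp θ| := by
  have hδ : 0 < |Real.exp γ - Real.exp θ| :=
    abs_pos.2 (sub_ne_zero.2 (Real.exp_injective.ne hθ))
  have h1 := abs_exp_sub_exp_le_norm (θ := θ) hw
  have hne : Complex.exp w - Real.exp θ ≠ 0 := norm_pos_iff.1 (hδ.trans_le h1)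
  have h2 : Complex.exp w / (Complex.exp w - Real.exp θ) =
      1 + Real.exp θ / (Complex.exp w - Real.exp θ) := by field_simp; ring
  rw [h2]
  refine (norm_add_le _ _).trans ?_
  rw [norm_one, norm_div, Complex.norm_real, Real.norm_eq_abs, Real.abs_exp]
  gcongr

lemma norm_exp_neg_mul_alphaC_le {k γ : ℝ} (hk : 0 ≤ k) (hγ : 0 < γ) {w : ℂ}
    (hw : w ∈ descentRegion γ) : ‖Complex.exp (-k * alphaC γ w)‖ ≤
      Real.exp (k * (Real.exp γ + Real.sinh γ * γ)) * Real.exp (-(k * Real.sinh γ) * w.re) := by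
  rw [Complex.norm_exp, ← Real.exp_add, Real.exp_le_exp, ← Complex.ofReal_neg,
    Complex.re_ofReal_mul, alphaC_re]
  have h7 : Real.cosh w.re * Real.cos w.im ≤ Real.exp γ := by
    have ha : 0 < w.re := hγ.trans_le hw.1
    rcases le_or_gt (Real.cos w.im) 0 with hcos | hcos
    · have := mul_nonpos_of_nonneg_of_nonpos (Real.cosh_pos w.re).le hcos
      linarith [Real.exp_pos γ]
    · refine le_trans ?_ hw.2
      refine mul_le_mul_of_nonneg_right ?_ hcos.le
      rw [← Real.cosh_add_sinh]
      linarith [Real.sinh_pos_iff.2 ha]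
  have h8 := Real.cosh_pos γ
  have h9 := mul_le_mul_of_nonneg_left
    (show -(Real.cosh γ - Real.cosh w.re * Real.cos w.im + Real.sinh γ * (w.re - γ)) ≤
      Real.exp γ + Real.sinh γ * γ - Real.sinh γ * w.re by linarith) hk
  linarith

lemma norm_logKernel_le {k γ θ : ℝ} (hk : 0 ≤ k) (hγ : 0 < γ) (hθ : γ ≠ θ) {w : ℂ}
    (hw : w ∈ descentRegion γ) :
    ‖logKernel k γ θ w‖ ≤ kernelBound k γ θ * Real.exp (-(k * Real.sinh γ) * w.re) := by
  rw [logKernel, norm_mul, kernelBound]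
  have h1 := norm_exp_neg_mul_alphaC_le hk hγ hw
  have h2 := norm_exp_div_le hθ hw
  calc _ ≤ (Real.exp (k * (Real.exp γ + Real.sinh γ * γ)) *
        Real.exp (-(k * Real.sinh γ) * w.re)) *
        (1 + Real.exp θ / |Real.exp γ - Real.exp θ|) := by gcongr
    _ = _ := by ring

lemma differentiableAt_logKernel {k γ θ : ℝ} {w : ℂ} (hw : Complex.exp w ≠ Real.exp θ) :
    DifferentiableAt ℂ (logKernel k γ θ) w := by
  have h1 : DifferentiableAt ℂ (alphaC γ) w :=
    (hasStrictDerivAt_alphaC γ w).hasDerivAt.differentiableAt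
  exact (h1.const_mul (-k : ℂ)).cexp.mul ((by fun_prop : DifferentiableAt ℂ Complex.exp w).div
    (by fun_prop) (sub_ne_zero.2 hw))

lemma differentiableOn_logKernel (k γ θ : ℝ) :
    DifferentiableOn ℂ (logKernel k γ θ) upperStrip := by
  intro w hw
  refine (differentiableAt_logKernel fun h => ?_).differentiableWithinAt
  have h1 := congrArg Complex.im h
  rw [Complex.exp_im, Complex.ofReal_im] at h1
  exact (mul_pos (Real.exp_pos _) (Real.sin_pos_of_pos_of_lt_pi hw.1 hw.2)).ne' h1

/-- The integral of `logKernel` over a path in the strip that stays in `descentRegion` and leads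
from `γ` to `∞` does not depend on the path. -/
lemma exists_integral_logKernel_eq {k γ θ : ℝ} (hk : 0 < k) (hγ : 0 < γ) (hθ : γ ≠ θ) :
    ∃ L : ℂ, ∀ p p' : ℝ → ℂ,
      (∀ u ∈ Ioi (0 : ℝ), p u ∈ upperStrip) → (∀ u ∈ Ioi (0 : ℝ), p u ∈ descentRegion γ) →
      (∀ u ∈ Ioi (0 : ℝ), HasDerivAt p (p' u) u) →
      Tendsto p (𝓝[>] 0) (𝓝 (γ : ℂ)) → Tendsto (fun u => (p u).re) atTop atTop →
      IntegrableOn (fun u => logKernel k γ θ (p u) * p' u) (Ioi 0) →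
      ∫ u in Ioi (0 : ℝ), logKernel k γ θ (p u) * p' u = L := by
  have hsγ : 0 < Real.sinh γ := Real.sinh_pos_iff.2 hγ
  obtain ⟨K, hK⟩ := exists_primitive_upperStrip (differentiableOn_logKernel k γ θ)
  -- The primitive is Lipschitz near `γ`, so it has a limit there.
  obtain ⟨L₀, hL₀⟩ : ∃ L₀, Tendsto K (𝓝[upperStrip] (γ : ℂ)) (𝓝 L₀) := by
    have hcont : ContinuousAt (logKernel k γ θ) (γ : ℂ) := by
      refine (differentiableAt_logKernel fun h => hθ ?_).continuousAt
      rw [← Complex.ofReal_exp] at h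
      exact Real.exp_injective (Complex.ofReal_injective h)
    obtain ⟨ε, hε, hball⟩ := Metric.eventually_nhds_iff_ball.1
      (hcont.norm.eventually (gt_mem_nhds (lt_add_one ‖logKernel k γ θ γ‖)))
    have hlip : LipschitzOnWith (‖logKernel k γ θ γ‖₊ + 1) K
        (upperStrip ∩ Metric.ball (γ : ℂ) ε) := by
      refine Convex.lipschitzOnWith_of_nnnorm_hasDerivWithin_le (f' := logKernel k γ θ)
        (convex_upperStrip.inter (convex_ball _ _)) (fun w hw => (hK w hw.1).hasDerivWithinAt)
        fun w hw => ?_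
      exact_mod_cast (hball w hw.2).le
    obtain ⟨g, hg, hgK⟩ := hlip.extend_finite_dimension
    refine ⟨g γ, ?_⟩
    have h1 := (hg.continuous.tendsto (γ : ℂ)).mono_left (nhdsWithin_le_nhds (s := upperStrip))
    refine h1.congr' ?_
    filter_upwards [self_mem_nhdsWithin, mem_nhdsWithin_of_mem_nhds (Metric.ball_mem_nhds _ hε)]
      with w h2 h3 using (hgK ⟨h2, h3⟩).symm
  -- The primitive has a limit at the right end of the line `Im w = π / 2`.
  have hmid : ∀ x : ℝ, γ ≤ x → (⟨x, Real.pi / 2⟩ : ℂ) ∈ descentRegion γ := by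
    intro x hx
    refine ⟨hx, ?_⟩
    rw [Real.cos_pi_div_two, mul_zero]
    exact (Real.exp_pos γ).le
  have hpi := Real.pi_pos
  have hmidS : ∀ x : ℝ, (⟨x, Real.pi / 2⟩ : ℂ) ∈ upperStrip := fun x =>
    ⟨by simp only []; linarith, by simp only []; linarith⟩
  obtain ⟨L₁, hL₁⟩ : ∃ L₁, Tendsto (fun x : ℝ => K ⟨x, Real.pi / 2⟩) atTop (𝓝 L₁) := by
    have hline : ∀ x : ℝ, HasDerivAt (fun x : ℝ => (⟨x, Real.pi / 2⟩ : ℂ)) 1 x := by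
      intro x
      have : (fun x : ℝ => (⟨x, Real.pi / 2⟩ : ℂ)) = fun x : ℝ =>
          (x : ℂ) + (Real.pi / 2 : ℝ) * Complex.I := by
        ext x; rw [← Complex.mk_eq_add_mul_I]
      rw [this]
      exact (Complex.ofRealCLM.hasDerivAt).add_const _
    refine ⟨_, tendsto_limUnder_of_hasDerivAt_of_integrableOn_Ioi (a := γ)
      (f' := fun x => logKernel k γ θ ⟨x, Real.pi / 2⟩) (fun x _ => ?_) ?_⟩
    · have h := (hK _ (hmidS x)).comp x (hline x)
      rwa [mul_one] at h
    · refine Integrable.mono' (g := fun x => kernelBound k γ θ *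
        Real.exp (-(k * Real.sinh γ) * x)) ?_ ?_ ?_
      · refine Integrable.const_mul ?_ _
        exact integrableOn_exp_mul_Ioi (neg_lt_zero.2 (by positivity)) γ
      · refine ContinuousOn.aestronglyMeasurable (fun x _ => ?_) measurableSet_Ioi
        refine ContinuousAt.continuousWithinAt ?_
        exact ContinuousAt.comp (f := fun x : ℝ => (⟨x, Real.pi / 2⟩ : ℂ))
          ((differentiableOn_logKernel k γ θ).differentiableAt
            (isOpen_upperStrip.mem_nhds (hmidS x))).continuousAt (hline x).continuousAt
      · filter_upwards [ae_restrict_mem measurableSet_Ioi] with x hx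
        exact norm_logKernel_le hk.le hγ hθ (hmid x (le_of_lt hx))
  -- Vertical segments far to the right contribute little, so this is also the limit along any path.
  have hvert : ∀ w ∈ upperStrip, w ∈ descentRegion γ →
      ‖K w - K ⟨w.re, Real.pi / 2⟩‖ ≤
        kernelBound k γ θ * Real.exp (-(k * Real.sinh γ) * w.re) * Real.pi := by
    intro w hwS hwD
    have hconv : Convex ℝ ({w.re} ×ℂ uIcc (Real.pi / 2) w.im) :=
      ((convex_singleton _).linear_preimage Complex.reLm).inter
        ((convex_uIcc _ _).linear_preimage Complex.imLm)
    have hS : ∀ v ∈ ({w.re} ×ℂ uIcc (Real.pi / 2) w.im), v ∈ upperStrip := by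
      intro v hv
      have h2 : v.im ∈ Icc (min (Real.pi / 2) w.im) (max (Real.pi / 2) w.im) := hv.2
      exact ⟨lt_of_lt_of_le (lt_min (by linarith) hwS.1) h2.1,
        lt_of_le_of_lt h2.2 (max_lt (by linarith) hwS.2)⟩
    have hD : ∀ v ∈ ({w.re} ×ℂ uIcc (Real.pi / 2) w.im), v ∈ descentRegion γ := by
      intro v hv
      have h1 : v.re = w.re := hv.1
      have h2 : v.im ∈ Icc (min (Real.pi / 2) w.im) (max (Real.pi / 2) w.im) := hv.2
      refine ⟨h1 ▸ hwD.1, ?_⟩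
      rw [h1]
      rcases le_total w.im (Real.pi / 2) with h | h
      · rw [min_eq_right h, max_eq_left h] at h2
        refine le_trans ?_ hwD.2
        have := Real.cos_le_cos_of_nonneg_of_le_pi hwS.1.le (hS v hv).2.le h2.1
        gcongr
      · rw [min_eq_left h, max_eq_right h] at h2
        have := Real.cos_nonpos_of_pi_div_two_le_of_le h2.1 (by linarith [(hS v hv).2])
        exact (mul_nonpos_of_nonneg_of_nonpos (Real.exp_pos _).le this).trans (Real.exp_pos γ).le
    have h := hconv.norm_image_sub_le_of_norm_hasDerivWithin_le (f := K) (f' := logKernel k γ θ)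
      (C := kernelBound k γ θ * Real.exp (-(k * Real.sinh γ) * w.re))
      (x := ⟨w.re, Real.pi / 2⟩) (y := w)
      (fun v hv => (hK v (hS v hv)).hasDerivWithinAt)
      (fun v hv => by
        have := norm_logKernel_le hk.le hγ hθ (hD v hv)
        rwa [show v.re = w.re from hv.1] at this)
      ⟨rfl, left_mem_uIcc⟩ ⟨rfl, right_mem_uIcc⟩
    refine h.trans ?_
    have hlen : ‖w - ⟨w.re, Real.pi / 2⟩‖ ≤ Real.pi := by
      refine (Complex.norm_le_abs_re_add_abs_im _).trans ?_
      simp only [Complex.sub_re, Complex.sub_im, sub_self, abs_zero, zero_add]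
      rw [abs_le]
      constructor <;> linarith [hwS.1, hwS.2]
    have := kernelBound_nonneg k γ θ
    gcongr
  refine ⟨L₁ - L₀, fun p p' hpS hpD hp hp0 hp1 hint => ?_⟩
  have hderiv : ∀ u ∈ Ioi (0 : ℝ),
      HasDerivAt (fun u => K (p u)) (logKernel k γ θ (p u) * p' u) u := fun u hu =>
    (hK _ (hpS u hu)).comp u (hp u hu)
  have ht0 : Tendsto (fun u => K (p u)) (𝓝[>] 0) (𝓝 L₀) := by
    refine hL₀.comp (tendsto_nhdsWithin_iff.2 ⟨hp0, ?_⟩)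
    filter_upwards [self_mem_nhdsWithin] with u hu using hpS u hu
  have ht1 : Tendsto (fun u => K (p u)) atTop (𝓝 L₁) := by
    have hsmall : Tendsto (fun u => K (p u) - K ⟨(p u).re, Real.pi / 2⟩) atTop (𝓝 0) := by
      refine squeeze_zero_norm' (a := fun u =>
        kernelBound k γ θ * Real.exp (-(k * Real.sinh γ) * (p u).re) * Real.pi) ?_ ?_
      · filter_upwards [eventually_gt_atTop 0] with u hu using hvert _ (hpS u hu) (hpD u hu)
      · have h := (Real.tendsto_exp_atBot.comp (hp1.const_mul_atTop_of_neg
          (neg_lt_zero.2 (by positivity : 0 < k * Real.sinh γ))))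
        have h2 := (h.const_mul (kernelBound k γ θ)).mul_const Real.pi
        simpa using h2
    have := hsmall.add (hL₁.comp hp1)
    simpa using this
  exact integral_Ioi_of_hasDerivAt_of_tendsto_of_tendsto hderiv hint ht0 ht1

/-! ### The integral over the vertical line -/

/-- The integrand of the contour integral, in the variable `z`. -/
noncomputable def kernel (k γ θ : ℝ) (z : ℂ) : ℂ :=
  Complex.exp (-k * alphaC γ (Complex.log z)) / (z - Real.exp θ)

/-- The vertical line `Re z = e^γ`. -/
noncomputable def line (γ y : ℝ) : ℂ := Real.exp γ + y * Complex.I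

lemma line_re (γ y : ℝ) : (line γ y).re = Real.exp γ := by simp [line, -Complex.ofReal_exp]

lemma line_im (γ y : ℝ) : (line γ y).im = y := by simp [line, -Complex.ofReal_exp]

lemma line_mem_slitPlane (γ y : ℝ) : line γ y ∈ Complex.slitPlane :=
  Complex.mem_slitPlane_iff.2 (Or.inl (by rw [line_re]; exact Real.exp_pos γ))

lemma line_ne_zero (γ y : ℝ) : line γ y ≠ 0 := Complex.slitPlane_ne_zero (line_mem_slitPlane γ y)

lemma line_ne_exp {γ θ : ℝ} (hθ : γ ≠ θ) (y : ℝ) : line γ y - Real.exp θ ≠ 0 := by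
  intro h
  have h1 := congrArg Complex.re h
  rw [Complex.sub_re, line_re, Complex.ofReal_re, Complex.zero_re, sub_eq_zero] at h1
  exact hθ (Real.exp_injective h1)

lemma log_line_mem_descentRegion (γ y : ℝ) : Complex.log (line γ y) ∈ descentRegion γ := by
  refine ⟨?_, ?_⟩
  · rw [Complex.log_re, Real.le_log_iff_exp_le (norm_pos_iff.2 (line_ne_zero γ y))]
    have := Complex.re_le_norm (line γ y)
    rwa [line_re] at this
  · rw [← Complex.exp_re, Complex.exp_log (line_ne_zero γ y), line_re]

lemma hasDerivAt_line (γ y : ℝ) : HasDerivAt (line γ) Complex.I y := by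
  have h := ((Complex.ofRealCLM.hasDerivAt (x := y)).mul_const Complex.I).const_add
    (Real.exp γ : ℂ)
  rwa [Complex.ofRealCLM_apply, Complex.ofReal_one, one_mul] at h

lemma continuous_line (γ : ℝ) : Continuous (line γ) :=
  continuous_iff_continuousAt.2 fun y => (hasDerivAt_line γ y).continuousAt

lemma continuous_kernel_line {k γ θ : ℝ} (hθ : γ ≠ θ) :
    Continuous fun y => kernel k γ θ (line γ y) := by
  have h1 : Continuous fun y => Complex.log (line γ y) :=
    (continuous_line γ).clog (line_mem_slitPlane γ)
  have h2 : Continuous (alphaC γ) :=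
    continuous_iff_continuousAt.2 fun w => (hasStrictDerivAt_alphaC γ w).hasDerivAt.continuousAt
  unfold kernel
  exact (Complex.continuous_exp.comp (continuous_const.mul (h2.comp h1))).div
    ((continuous_line γ).sub continuous_const) (line_ne_exp hθ)

lemma logKernel_log {k γ θ : ℝ} {z : ℂ} (hz : z ≠ 0) :
    logKernel k γ θ (Complex.log z) = z * kernel k γ θ z := by
  rw [logKernel, kernel, Complex.exp_log hz]; ring

lemma integrable_kernel_line {k γ θ : ℝ} (hk : 0 < k) (hγ : 0 < γ) (hθ : γ ≠ θ) :
    Integrable fun y => kernel k γ θ (line γ y) := by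
  have hsγ : 0 < Real.sinh γ := Real.sinh_pos_iff.2 hγ
  set r := 1 + k * Real.sinh γ with hr
  have hr1 : 1 < r := by rw [hr]; linarith [mul_pos hk hsγ]
  have hint : Integrable fun y : ℝ => kernelBound k γ θ * ((1 : ℝ) + ‖y‖ ^ 2) ^ (-r / 2) :=
    (integrable_rpow_neg_one_add_norm_sq (by simpa using hr1)).const_mul _
  refine hint.mono' (continuous_kernel_line hθ).aestronglyMeasurable
    (Eventually.of_forall fun y => ?_)
  have hz := line_ne_zero γ y
  have hz' := norm_pos_iff.2 hz
  have h1 := norm_logKernel_le hk.le hγ hθ (log_line_mem_descentRegion γ y)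
  rw [logKernel_log hz, norm_mul, Complex.log_re] at h1
  have h2 : (1 + ‖y‖ ^ 2) ≤ ‖line γ y‖ ^ 2 := by
    rw [← Complex.normSq_eq_norm_sq, Complex.normSq_apply, line_re, line_im, Real.norm_eq_abs,
      sq_abs]
    nlinarith [Real.one_le_exp hγ.le]
  have h3 : Real.exp (-(k * Real.sinh γ) * Real.log ‖line γ y‖) / ‖line γ y‖ ≤
      (1 + ‖y‖ ^ 2) ^ (-r / 2) := by
    calc Real.exp (-(k * Real.sinh γ) * Real.log ‖line γ y‖) / ‖line γ y‖
        = (‖line γ y‖ ^ 2) ^ (-r / 2) := by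
          rw [Real.rpow_def_of_pos (by positivity), Real.log_pow,
            show (2 : ℕ) * Real.log ‖line γ y‖ * (-r / 2) =
              -(k * Real.sinh γ) * Real.log ‖line γ y‖ - Real.log ‖line γ y‖ by
                rw [hr]; push_cast; ring, Real.exp_sub, Real.exp_log hz']
      _ ≤ _ := Real.rpow_le_rpow_of_nonpos (by positivity) h2 (by linarith)
  calc ‖kernel k γ θ (line γ y)‖ = (‖line γ y‖ * ‖kernel k γ θ (line γ y)‖) / ‖line γ y‖ := by
        field_simp
    _ ≤ (kernelBound k γ θ * Real.exp (-(k * Real.sinh γ) * Real.log ‖line γ y‖)) /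
        ‖line γ y‖ := by gcongr
    _ = kernelBound k γ θ *
        (Real.exp (-(k * Real.sinh γ) * Real.log ‖line γ y‖) / ‖line γ y‖) := by ring
    _ ≤ _ := by
        have := kernelBound_nonneg k γ θ
        gcongr

lemma kernel_conj {k γ θ : ℝ} {z : ℂ} (hz : z ∈ Complex.slitPlane) :
    kernel k γ θ (starRingEnd ℂ z) = starRingEnd ℂ (kernel k γ θ z) := by
  rw [kernel, kernel, Complex.log_conj _ (Complex.slitPlane_arg_ne_pi hz), alphaC_conj, map_div₀,
    ← Complex.exp_conj, map_mul, map_neg, Complex.conj_ofReal, map_sub, Complex.conj_ofReal]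

lemma line_neg (γ y : ℝ) : line γ (-y) = starRingEnd ℂ (line γ y) := by
  apply Complex.ext <;> simp [line_re, line_im]

/-- By conjugation symmetry the integral over the line is twice the real part of the integral over
its upper half. -/
lemma integral_kernel_line {k γ θ : ℝ} (hk : 0 < k) (hγ : 0 < γ) (hθ : γ ≠ θ) :
    ∫ y, kernel k γ θ (line γ y) =
      ((2 * (∫ y in Ioi (0 : ℝ), kernel k γ θ (line γ y)).re : ℝ) : ℂ) := by
  have hint := integrable_kernel_line hk hγ hθ
  have h1 := integral_add_compl (measurableSet_Ioi (a := (0 : ℝ))) hint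
  rw [compl_Ioi, ← neg_zero, ← integral_comp_neg_Ioi, neg_zero] at h1
  simp_rw [line_neg, kernel_conj (line_mem_slitPlane γ _)] at h1
  rw [integral_conj, Complex.add_conj] at h1
  exact h1.symm

lemma hasDerivAt_log_line (γ y : ℝ) :
    HasDerivAt (fun y => Complex.log (line γ y)) (Complex.I / line γ y) y :=
  (hasDerivAt_line γ y).clog_real (line_mem_slitPlane γ y)

lemma tendsto_log_line_re_atTop (γ : ℝ) :
    Tendsto (fun y => (Complex.log (line γ y)).re) atTop atTop := by
  simp only [Complex.log_re]
  refine Real.tendsto_log_atTop.comp (tendsto_atTop_mono (fun y => ?_) tendsto_id)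
  have := (le_abs_self _).trans (Complex.abs_im_le_norm (line γ y))
  rwa [line_im] at this

/-- Contour deformation: the upper half of the vertical line may be replaced by the upper half of
the steepest descent path. -/
lemma integral_line_eq_integral_descentPath {k γ θ : ℝ} (hk : 0 < k) (hγ : 0 < γ) (hθ : γ ≠ θ)
    (hint : IntegrableOn (fun u => logKernel k γ θ (descentPath γ u) * descentVelocity γ u)
      (Ioi 0)) :
    (∫ y in Ioi (0 : ℝ), kernel k γ θ (line γ y)) * Complex.I =
      ∫ u in Ioi (0 : ℝ), logKernel k γ θ (descentPath γ u) * descentVelocity γ u := by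
  obtain ⟨L, hL⟩ := exists_integral_logKernel_eq hk hγ hθ
  rw [hL (descentPath γ) (descentVelocity γ)
    (fun u hu => ⟨descentPath_im_pos hγ hu, descentPath_im_lt_pi hγ hu⟩)
    (fun u hu => ⟨(lt_descentPath_re hγ hu).le, exp_mul_cos_descentPath_le hγ hu⟩)
    (fun u hu => hasDerivAt_descentPath hγ (ne_of_gt hu)) (tendsto_descentPath_nhdsWithin_zero hγ)
    (tendsto_descentPath_re_atTop hγ) hint]
  have heq : ∀ y, logKernel k γ θ (Complex.log (line γ y)) * (Complex.I / line γ y) =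
      kernel k γ θ (line γ y) * Complex.I := by
    intro y
    have := line_ne_zero γ y
    rw [logKernel_log this]
    field_simp
  have h := hL (fun y => Complex.log (line γ y)) (fun y => Complex.I / line γ y) ?_
    (fun y _ => log_line_mem_descentRegion γ y) (fun y _ => hasDerivAt_log_line γ y) ?_
    (tendsto_log_line_re_atTop γ) ?_
  · simp_rw [heq] at h
    rw [integral_mul_const] at h
    exact h
  · intro y hy
    have him : 0 < (line γ y).im := by rw [line_im]; exact hy
    exact ⟨pos_of_mul_pos_left (mul_pos_of_sign_eq him.ne' (sign_log_im _ him.ne')) him.le,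
      log_im_lt_pi _ him.ne'⟩
  · have h0 : Complex.log (line γ 0) = γ := by
      rw [line, Complex.ofReal_zero, zero_mul, add_zero, ← Complex.ofReal_log (Real.exp_pos γ).le,
        Real.log_exp]
    have := (hasDerivAt_log_line γ 0).continuousAt.tendsto
    simp only [h0] at this
    exact this.mono_left nhdsWithin_le_nhds
  · simp_rw [heq]
    exact ((integrable_kernel_line hk hγ hθ).mul_const _).integrableOn

lemma descentPath_mem_descentRegion {γ : ℝ} (hγ : 0 < γ) {u : ℝ} (hu : 0 < u) :
    descentPath γ u ∈ descentRegion γ :=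
  ⟨(lt_descentPath_re hγ hu).le, exp_mul_cos_descentPath_le hγ hu⟩

lemma logKernel_descentPath {n : ℕ} {γ θ : ℝ} (hγ : 0 < γ) {u : ℝ} (hu : 0 < u) :
    logKernel (n / (2 * Real.sinh γ)) γ θ (descentPath γ u) * descentVelocity γ u =
      -(ffun γ θ u * (Real.exp (-(n * u ^ 2) / (4 * Real.sinh γ)) : ℝ)) := by
  have hsγ : 0 < Real.sinh γ := Real.sinh_pos_iff.2 hγ
  have hE : Complex.exp (-((n / (2 * Real.sinh γ) : ℝ) : ℂ) * alphaC γ (descentPath γ u)) =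
      (Real.exp (-(n * u ^ 2) / (4 * Real.sinh γ)) : ℝ) := by
    rw [alphaC_descentPath hγ hu.ne', Complex.ofReal_exp]
    congr 1
    rw [← Complex.ofReal_neg, ← Complex.ofReal_mul]
    congr 1
    field_simp
    ring
  rw [logKernel, hE, ffun, (hasDerivAt_tfun hγ hu.ne').deriv, ← exp_descentPath hγ hu.ne',
    descentVelocity, ← neg_sub (Complex.exp (descentPath γ u)), div_neg]
  ring

lemma integrableOn_ffun_mul_exp {n : ℕ} (hn : 1 ≤ n) {γ θ : ℝ} (hγ : 0 < γ) (hθ : γ ≠ θ) :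
    IntegrableOn (fun u => logKernel (n / (2 * Real.sinh γ)) γ θ (descentPath γ u) *
      descentVelocity γ u) (Ioi 0) := by
  have hsγ : 0 < Real.sinh γ := Real.sinh_pos_iff.2 hγ
  have hn' : (0 : ℝ) < n := by exact_mod_cast hn
  have hbase := integrableOn_descentVelocity_mul_exp (c := n / (4 * Real.sinh γ)) hγ (by positivity)
  have hbd : IntegrableOn (fun u => (Complex.exp (descentPath γ u) /
      (Complex.exp (descentPath γ u) - Real.exp θ)) *
      (descentVelocity γ u * (Real.exp (-(n / (4 * Real.sinh γ)) * u ^ 2) : ℝ))) (Ioi 0) := by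
    refine Integrable.bdd_mul (c := 1 + Real.exp θ / |Real.exp γ - Real.exp θ|) hbase ?_ ?_
    · refine ContinuousOn.aestronglyMeasurable ?_ measurableSet_Ioi
      have hexp := Complex.continuous_exp.comp_continuousOn (continuousOn_descentPath hγ)
      refine hexp.div (hexp.sub continuousOn_const) fun u hu => norm_pos_iff.1 ?_
      exact (abs_pos.2 (sub_ne_zero.2 (Real.exp_injective.ne hθ))).trans_le
        (abs_exp_sub_exp_le_norm (descentPath_mem_descentRegion hγ hu))
    · filter_upwards [ae_restrict_mem measurableSet_Ioi] with u hu
      exact norm_exp_div_le hθ (descentPath_mem_descentRegion hγ hu)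
  refine hbd.congr ?_
  filter_upwards [ae_restrict_mem measurableSet_Ioi] with u hu
  rw [logKernel, alphaC_descentPath hγ (ne_of_gt hu), ← Complex.ofReal_neg, ← Complex.ofReal_mul,
    ← Complex.ofReal_exp]
  rw [show -(n / (2 * Real.sinh γ)) * (u ^ 2 / 2) = -(n / (4 * Real.sinh γ)) * u ^ 2 by
    field_simp; ring]
  ring

lemma integrableOn_gIntegrand {n : ℕ} (hn : 1 ≤ n) {γ θ : ℝ} (hγ : 0 < γ) (hθ : γ ≠ θ) :
    IntegrableOn (gIntegrand n γ θ) (Ioi 0) := by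
  refine (integrableOn_ffun_mul_exp hn hγ hθ).im.neg.congr ?_
  filter_upwards [ae_restrict_mem measurableSet_Ioi] with u hu
  simp only [Pi.neg_apply, logKernel_descentPath hγ hu, gIntegrand, RCLike.im_to_complex,
    Complex.neg_im, Complex.im_mul_ofReal, neg_neg]

/-- The contour integral equals `-2π g`. -/
lemma integral_kernel_line_eq_gfun {n : ℕ} (hn : 1 ≤ n) {γ θ : ℝ} (hγ : 0 < γ) (hθ : γ ≠ θ) :
    ∫ y, kernel (n / (2 * Real.sinh γ)) γ θ (line γ y) =
      ((-(2 * Real.pi) * gfun n γ θ : ℝ) : ℂ) := by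
  have hsγ : 0 < Real.sinh γ := Real.sinh_pos_iff.2 hγ
  have hn' : (0 : ℝ) < n := by exact_mod_cast hn
  have hk : 0 < n / (2 * Real.sinh γ) := by positivity
  have hint := integrableOn_ffun_mul_exp hn hγ hθ
  have h := congrArg Complex.im (integral_line_eq_integral_descentPath hk hγ hθ hint)
  rw [Complex.mul_I_im] at h
  have h2 : (∫ u in Ioi (0 : ℝ), logKernel (n / (2 * Real.sinh γ)) γ θ (descentPath γ u) *
      descentVelocity γ u).im = -∫ u in Ioi (0 : ℝ), gIntegrand n γ θ u := by
    rw [← RCLike.im_to_complex, ← integral_im hint, ← integral_neg]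
    refine setIntegral_congr_fun measurableSet_Ioi fun u hu => ?_
    simp only [logKernel_descentPath hγ hu, gIntegrand, RCLike.im_to_complex,
      Complex.neg_im, Complex.im_mul_ofReal]
  rw [integral_kernel_line hk hγ hθ, h, h2, gfun]
  congr 1
  field_simp

/-- With `z = e^θ (1 + 2τ)` the inverse Laplace integrand of the chi-squared law becomes the
kernel, whose exponent is `-k α(ln z)`. -/
lemma exp_mul_complexMGF_chiSq_div {n : ℕ} (hn : 1 ≤ n) {γ θ : ℝ} (hγ : 0 < γ) {τ : ℂ}
    (hτ : -(1 / 2) < τ.re) {z : ℂ} (hz : z = Real.exp θ * (1 + 2 * τ)) (hτ0 : τ.re ≠ 0) :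
    Complex.exp (τ * (n / (2 * Real.sinh γ) * Real.exp θ : ℝ)) *
      complexMGF id (chiSq n (n / (2 * Real.sinh γ) * Real.exp (-θ))) (-τ) / τ =
      Real.exp (n / (2 * Real.sinh γ) * alpha γ θ) * (2 * Real.exp θ) *
        kernel (n / (2 * Real.sinh γ)) γ θ z := by
  have hsγ : 0 < Real.sinh γ := Real.sinh_pos_iff.2 hγ
  have hsγ' : (Real.sinh γ : ℂ) ≠ 0 := by exact_mod_cast hsγ.ne'
  have hζre : 0 < (1 + 2 * τ).re := by simp; linarith
  have hζ0 : (1 + 2 * τ) ≠ 0 := fun h => by rw [h] at hζre; simp at hζre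
  have hτne : τ ≠ 0 := fun h => hτ0 (by rw [h]; rfl)
  have hlog : Complex.log z = θ + Complex.log (1 + 2 * τ) := by
    rw [hz, Complex.log_ofReal_mul (Real.exp_pos θ) hζ0, Real.log_exp]
  have hez : (Real.exp θ : ℂ) ≠ 0 := by exact_mod_cast (Real.exp_pos θ).ne'
  have hden : z - Real.exp θ = 2 * Real.exp θ * τ := by rw [hz]; ring
  have hz0 : z ≠ 0 := by rw [hz]; exact mul_ne_zero hez hζ0
  have hcosh : Complex.cosh (Complex.log z) = (z + z⁻¹) / 2 := by
    rw [Complex.cosh, Complex.exp_neg, Complex.exp_log hz0]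
  have key : τ * ((n / (2 * Real.sinh γ) * Real.exp θ : ℝ) : ℂ) + (-(n / 2) *
      Complex.log (1 - 2 * -τ) + -τ * ((n / (2 * Real.sinh γ) * Real.exp (-θ) : ℝ) : ℂ) /
        (1 - 2 * -τ)) = ((n / (2 * Real.sinh γ) * alpha γ θ : ℝ) : ℂ) +
      -((n / (2 * Real.sinh γ) : ℝ) : ℂ) * alphaC γ (Complex.log z) := by
    rw [alphaC, hcosh, hlog, alpha, hz, Real.exp_neg, ← Complex.ofReal_sinh, ← Complex.ofReal_cosh,
      Real.cosh_eq θ, Real.exp_neg θ, show (1 : ℂ) - 2 * -τ = 1 + 2 * τ by ring]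
    simp only [Complex.ofReal_mul, Complex.ofReal_add, Complex.ofReal_sub, Complex.ofReal_div,
      Complex.ofReal_natCast, Complex.ofReal_ofNat, Complex.ofReal_inv]
    generalize hζ : 1 + 2 * τ = ζ at hζ0
    rw [show τ = (ζ - 1) / 2 by rw [← hζ]; ring]
    field_simp
    ring
  rw [complexMGF_chiSq hn (by positivity) (by simp; linarith), ← Complex.exp_add, key,
    Complex.exp_add, kernel, hden, Complex.ofReal_exp (_ * alpha γ θ)]
  field_simp

/-! ### The integral representation -/

/-- The point `e^θ (1 + 2τ)` runs through the line `Re z = e^γ` when `τ` runs through a vertical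
line. -/
lemma line_eq_exp_mul {γ θ σ : ℝ} (hσ : 1 + 2 * σ = Real.exp (γ - θ)) (y : ℝ) :
    line γ (4 * Real.pi * Real.exp θ * y) =
      Real.exp θ * (1 + 2 * (σ + 2 * Real.pi * y * Complex.I)) := by
  have h : Real.exp γ = Real.exp θ * (1 + 2 * σ) := by
    rw [hσ, ← Real.exp_add]; congr 1; ring
  rw [line, h]
  push_cast
  ring

lemma integral_comp_four_pi_exp_mul (θ : ℝ) (f : ℝ → ℂ) :
    ∫ y : ℝ, f (4 * Real.pi * Real.exp θ * y) =
      ((4 * Real.pi * Real.exp θ)⁻¹ : ℝ) • ∫ y, f y := by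
  rw [Measure.integral_comp_mul_left, abs_of_pos (by positivity)]

lemma complexMGF_id_map_neg (ν : Measure ℝ) (τ : ℂ) :
    complexMGF id (ν.map fun x => -x) τ = complexMGF id ν (-τ) := by
  rw [complexMGF_id_map (by fun_prop), complexMGF, complexMGF]
  simp

lemma integrable_of_kernel {n : ℕ} (hn : 1 ≤ n) {γ θ : ℝ} (hγ : 0 < γ) (hθ : γ ≠ θ) :
    Integrable fun y => kernel (n / (2 * Real.sinh γ)) γ θ
      (line γ (4 * Real.pi * Real.exp θ * y)) := by
  have hsγ : 0 < Real.sinh γ := Real.sinh_pos_iff.2 hγ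
  have hn' : (0 : ℝ) < n := by exact_mod_cast hn
  exact (integrable_kernel_line (by positivity) hγ hθ).comp_mul_left' (by positivity)

/-- The contour integral after rescaling the line. -/
lemma integral_kernel_line_rescaled {n : ℕ} (hn : 1 ≤ n) {γ θ : ℝ} (hγ : 0 < γ) (hθ : γ ≠ θ) :
    ∫ y, (Real.exp (n / (2 * Real.sinh γ) * alpha γ θ) : ℂ) * (2 * Real.exp θ) *
        kernel (n / (2 * Real.sinh γ)) γ θ (line γ (4 * Real.pi * Real.exp θ * y)) =
      ((-(gfun n γ θ * Real.exp (-(1 / 2) * n * vfun γ θ)) : ℝ) : ℂ) := by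
  have hsγ : 0 < Real.sinh γ := Real.sinh_pos_iff.2 hγ
  have hv : -(1 / 2) * n * vfun γ θ = n / (2 * Real.sinh γ) * alpha γ θ := by
    rw [vfun]; field_simp
  rw [integral_const_mul, integral_comp_four_pi_exp_mul θ
    (fun y => kernel (n / (2 * Real.sinh γ)) γ θ (line γ y)),
    integral_kernel_line_eq_gfun hn hγ hθ, hv, Complex.real_smul]
  have h1 : (Real.pi : ℂ) ≠ 0 := by exact_mod_cast Real.pi_ne_zero
  have h2 : (Real.exp θ : ℂ) ≠ 0 := by exact_mod_cast (Real.exp_pos θ).ne'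
  simp only [Complex.ofReal_mul, Complex.ofReal_neg, Complex.ofReal_inv, Complex.ofReal_ofNat]
  field_simp
  norm_num

/-- The case `θ < γ`: the line lies in `Re τ > 0`, to the right of the pole. -/
lemma chiSq_Iic_eq_of_lt {n : ℕ} (hn : 1 ≤ n) {γ θ : ℝ} (hγ : 0 < γ) (hθ : θ < γ) :
    (chiSq n (n / (2 * Real.sinh γ) * Real.exp (-θ))).real
        (Iic (n / (2 * Real.sinh γ) * Real.exp θ)) =
      -(gfun n γ θ * Real.exp (-(1 / 2) * n * vfun γ θ)) := by
  have hsγ : 0 < Real.sinh γ := Real.sinh_pos_iff.2 hγ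
  set s := n / (2 * Real.sinh γ) * Real.exp (-θ) with hs
  set a := n / (2 * Real.sinh γ) * Real.exp θ with ha
  have hs0 : 0 ≤ s := by positivity
  set σ := (Real.exp (γ - θ) - 1) / 2 with hσ
  have hσ1 : 1 + 2 * σ = Real.exp (γ - θ) := by rw [hσ]; ring
  have hσ0 : 0 < σ := by
    have := Real.one_lt_exp_iff.2 (sub_pos.2 hθ)
    rw [hσ]; linarith
  have hker : ∀ y : ℝ, Complex.exp ((σ + 2 * Real.pi * y * Complex.I) * (a : ℝ)) *
      complexMGF id (chiSq n s) (-(σ + 2 * Real.pi * y * Complex.I)) /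
        (σ + 2 * Real.pi * y * Complex.I) =
      (Real.exp (n / (2 * Real.sinh γ) * alpha γ θ) : ℂ) * (2 * Real.exp θ) *
        kernel (n / (2 * Real.sinh γ)) γ θ (line γ (4 * Real.pi * Real.exp θ * y)) := by
    intro y
    exact exp_mul_complexMGF_chiSq_div hn hγ (by simp; linarith) (line_eq_exp_mul hσ1 y)
      (by simpa using hσ0.ne')
  have hexp : ∀ y : ℝ, complexMGF id (chiSq n s) (-(σ + 2 * Real.pi * y * Complex.I)) /
        (σ + 2 * Real.pi * y * Complex.I) =
      Complex.exp (-((σ + 2 * Real.pi * y * Complex.I) * (a : ℝ))) *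
      (Complex.exp ((σ + 2 * Real.pi * y * Complex.I) * (a : ℝ)) *
      complexMGF id (chiSq n s) (-(σ + 2 * Real.pi * y * Complex.I)) /
        (σ + 2 * Real.pi * y * Complex.I)) := by
    intro y
    rw [mul_div_assoc, ← mul_assoc, ← Complex.exp_add, neg_add_cancel, Complex.exp_zero, one_mul]
  have hM : Integrable fun y : ℝ =>
      complexMGF id (chiSq n s) (-(σ + 2 * Real.pi * y * Complex.I)) /
        (σ + 2 * Real.pi * y * Complex.I) := by
    simp_rw [hexp, hker]
    refine Integrable.bdd_mul (c := Real.exp (-(σ * a)))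
      ((integrable_of_kernel hn hγ hθ.ne').const_mul _) ?_ (Eventually.of_forall fun y => ?_)
    · exact Continuous.aestronglyMeasurable (by fun_prop)
    · rw [Complex.norm_exp]; simp
  have h := exp_mul_real_Iic_eq_integral (chiSq n s) (a := a) hσ0
    (integrable_exp_mul_chiSq hn hs0 (by linarith)) (chiSq_singleton hn s a) hM
  have h2 : (((chiSq n s).real (Iic a) : ℝ) : ℂ) = ∫ y : ℝ,
      (Real.exp (n / (2 * Real.sinh γ) * alpha γ θ) : ℂ) * (2 * Real.exp θ) *
        kernel (n / (2 * Real.sinh γ)) γ θ (line γ (4 * Real.pi * Real.exp θ * y)) := by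
    have h3 : (((chiSq n s).real (Iic a) : ℝ) : ℂ) = (Real.exp (σ * a) : ℝ) *
        ((Real.exp (-σ * a) * (chiSq n s).real (Iic a) : ℝ) : ℂ) := by
      rw [← Complex.ofReal_mul, ← mul_assoc, ← Real.exp_add]; simp
    rw [h3, h, ← integral_const_mul]
    refine integral_congr_ae (Eventually.of_forall fun y => ?_)
    simp only [← hker]
    rw [Complex.ofReal_exp, ← mul_assoc, ← Complex.exp_add, mul_div_assoc]
    congr 2
    push_cast; ring
  rw [integral_kernel_line_rescaled hn hγ hθ.ne'] at h2
  exact_mod_cast h2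

/-- The case `γ < θ`: the line lies in `-1/2 < Re τ < 0`, to the left of the pole, and the inversion
formula is applied to the law of `-‖Z‖²`. -/
lemma chiSq_Ici_eq_of_lt {n : ℕ} (hn : 1 ≤ n) {γ θ : ℝ} (hγ : 0 < γ) (hθ : γ < θ) :
    (chiSq n (n / (2 * Real.sinh γ) * Real.exp (-θ))).real
        (Ici (n / (2 * Real.sinh γ) * Real.exp θ)) =
      gfun n γ θ * Real.exp (-(1 / 2) * n * vfun γ θ) := by
  have hsγ : 0 < Real.sinh γ := Real.sinh_pos_iff.2 hγ
  set s := n / (2 * Real.sinh γ) * Real.exp (-θ) with hs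
  set a := n / (2 * Real.sinh γ) * Real.exp θ with ha
  have hs0 : 0 ≤ s := by positivity
  set σ := (1 - Real.exp (γ - θ)) / 2 with hσ
  have hσ1 : 1 + 2 * (-σ) = Real.exp (γ - θ) := by rw [hσ]; ring
  have hσ0 : 0 < σ := by
    have := Real.exp_lt_one_iff.2 (sub_neg.2 hθ)
    rw [hσ]; linarith
  have hσ2 : σ < 1 / 2 := by
    have := Real.exp_pos (γ - θ)
    rw [hσ]; linarith
  set ν := (chiSq n s).map (fun x => -x) with hν
  have : IsProbabilityMeasure ν := Measure.isProbabilityMeasure_map (by fun_prop)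
  have hmgf : ∀ y : ℝ, complexMGF id ν (-(σ + 2 * Real.pi * y * Complex.I)) =
      complexMGF id (chiSq n s) (σ + 2 * Real.pi * y * Complex.I) := by
    intro y; rw [hν, complexMGF_id_map_neg, neg_neg]
  have hker : ∀ y : ℝ, Complex.exp (-((σ + 2 * Real.pi * y * Complex.I) * (a : ℝ))) *
      (complexMGF id ν (-(σ + 2 * Real.pi * y * Complex.I)) /
        (σ + 2 * Real.pi * y * Complex.I)) =
      -((Real.exp (n / (2 * Real.sinh γ) * alpha γ θ) : ℂ) * (2 * Real.exp θ) *
        kernel (n / (2 * Real.sinh γ)) γ θ (line γ (4 * Real.pi * Real.exp θ * (-y)))) := by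
    intro y
    have h := exp_mul_complexMGF_chiSq_div hn hγ (τ := -(σ + 2 * Real.pi * y * Complex.I))
      (by simp; linarith) (z := line γ (4 * Real.pi * Real.exp θ * (-y)))
      (by rw [line_eq_exp_mul hσ1]; push_cast; ring) (by simpa using hσ0.ne')
    rw [← h, hmgf, neg_neg, neg_mul, div_neg, neg_neg, mul_div_assoc]
  have hexp : ∀ y : ℝ, complexMGF id ν (-(σ + 2 * Real.pi * y * Complex.I)) /
        (σ + 2 * Real.pi * y * Complex.I) =
      Complex.exp ((σ + 2 * Real.pi * y * Complex.I) * (a : ℝ)) *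
      (Complex.exp (-((σ + 2 * Real.pi * y * Complex.I) * (a : ℝ))) *
      (complexMGF id ν (-(σ + 2 * Real.pi * y * Complex.I)) /
        (σ + 2 * Real.pi * y * Complex.I))) := by
    intro y
    rw [← mul_assoc, ← Complex.exp_add, add_neg_cancel, Complex.exp_zero, one_mul]
  have hM : Integrable fun y : ℝ =>
      complexMGF id ν (-(σ + 2 * Real.pi * y * Complex.I)) /
        (σ + 2 * Real.pi * y * Complex.I) := by
    rw [funext hexp]
    simp_rw [hker]
    refine Integrable.bdd_mul (c := Real.exp (σ * a))
      (((integrable_of_kernel hn hγ hθ.ne).comp_neg).const_mul _).neg ?_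
      (Eventually.of_forall fun y => ?_)
    · exact Continuous.aestronglyMeasurable (by fun_prop)
    · rw [Complex.norm_exp]; simp
  have hpre : ∀ t, (fun x : ℝ => -x) ⁻¹' (Iic (-t)) = Ici t := by intro t; ext x; simp
  have hatom : ν {-a} = 0 := by
    rw [hν, Measure.map_apply (by fun_prop) (measurableSet_singleton _)]
    have : (fun x : ℝ => -x) ⁻¹' {-a} = {a} := by ext x; simp
    rw [this]; exact chiSq_singleton hn s a
  have hexpint : Integrable (fun x => Real.exp (-σ * x)) ν := by
    rw [hν, integrable_map_measure (by fun_prop) (by fun_prop)]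
    simpa [Function.comp_def] using integrable_exp_mul_chiSq hn hs0 hσ2
  have h := exp_mul_real_Iic_eq_integral ν (a := -a) hσ0 hexpint hatom hM
  rw [hν, map_measureReal_apply (by fun_prop) measurableSet_Iic, hpre, ← hν] at h
  have h2 : (((chiSq n s).real (Ici a) : ℝ) : ℂ) = ∫ y : ℝ,
      -((Real.exp (n / (2 * Real.sinh γ) * alpha γ θ) : ℂ) * (2 * Real.exp θ) *
        kernel (n / (2 * Real.sinh γ)) γ θ (line γ (4 * Real.pi * Real.exp θ * (-y)))) := by
    have h3 : (((chiSq n s).real (Ici a) : ℝ) : ℂ) = (Real.exp (-(σ * a)) : ℝ) *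
        ((Real.exp (-σ * -a) * (chiSq n s).real (Ici a) : ℝ) : ℂ) := by
      rw [← Complex.ofReal_mul, ← mul_assoc, ← Real.exp_add]; simp
    rw [h3, h, ← integral_const_mul]
    refine integral_congr_ae (Eventually.of_forall fun y => ?_)
    simp only [← hker]
    rw [Complex.ofReal_exp, ← mul_assoc, ← Complex.exp_add]
    congr 2
    push_cast; ring
  rw [integral_neg, integral_neg_eq_self (fun y =>
    (Real.exp (n / (2 * Real.sinh γ) * alpha γ θ) : ℂ) * (2 * Real.exp θ) *
      kernel (n / (2 * Real.sinh γ)) γ θ (line γ (4 * Real.pi * Real.exp θ * y))),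
    integral_kernel_line_rescaled hn hγ hθ.ne, ← Complex.ofReal_neg, neg_neg] at h2
  exact_mod_cast h2

lemma chiSqCDF_eq {n : ℕ} (hn : 1 ≤ n) {γ θ : ℝ} (hγ : 0 < γ) (hθ : γ ≠ θ) :
    chiSqCDF (n / (2 * Real.sinh γ) * Real.exp θ) n (n / (2 * Real.sinh γ) * Real.exp (-θ)) =
      unitStep (-sgn γ θ) - gfun n γ θ * Real.exp (-(1 / 2) * n * vfun γ θ) := by
  rw [chiSqCDF, sgn]
  rcases lt_or_gt_of_ne hθ with h | h
  · have h1 := chiSq_Ici_eq_of_lt hn hγ h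
    rw [Real.sign_of_neg (sub_neg.2 h), unitStep, if_pos (by norm_num), ← h1]
    set s := n / (2 * Real.sinh γ) * Real.exp (-θ)
    set a := n / (2 * Real.sinh γ) * Real.exp θ
    have h2 : (chiSq n s).real (Ici a) = (chiSq n s).real (Ioi a) := by
      rw [← Ioi_union_left, measureReal_union (by simp) (measurableSet_singleton a)]
      rw [measureReal_def (s := {a}), chiSq_singleton hn]; simp
    have h3 := probReal_compl_eq_one_sub (μ := chiSq n s) (measurableSet_Iic (a := a))
    rw [compl_Iic] at h3
    rw [h2]; linarith
  · rw [chiSq_Iic_eq_of_lt hn hγ h, Real.sign_of_pos (sub_pos.2 h), unitStep,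
      if_neg (by norm_num), zero_sub]

lemma chiSqCCDF_eq {n : ℕ} (hn : 1 ≤ n) {γ θ : ℝ} (hγ : 0 < γ) (hθ : γ ≠ θ) :
    chiSqCCDF (n / (2 * Real.sinh γ) * Real.exp θ) n (n / (2 * Real.sinh γ) * Real.exp (-θ)) =
      unitStep (sgn γ θ) + gfun n γ θ * Real.exp (-(1 / 2) * n * vfun γ θ) := by
  have h1 := chiSqCDF_eq hn hγ hθ
  rw [chiSqCDF] at h1
  rw [chiSqCCDF, ← compl_Iic, probReal_compl_eq_one_sub measurableSet_Iic, h1]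
  have h2 : unitStep (sgn γ θ) + unitStep (-sgn γ θ) = 1 := by
    rw [sgn]
    rcases lt_or_gt_of_ne hθ with h | h
    · rw [Real.sign_of_neg (sub_neg.2 h), unitStep, unitStep, if_neg (by norm_num),
        if_pos (by norm_num), zero_add]
    · rw [Real.sign_of_pos (sub_pos.2 h), unitStep, unitStep, if_pos (by norm_num),
        if_neg (by norm_num), add_zero]
  linarith

end AWGN

theorem theorem3 (n : ℕ) (hn : 1 ≤ n) (vx vw : ℝ≥0) (hvx : 0 < vx) (hvw : 0 < vw)
    (Ω : ℝ) (hΩ : Ω = AWGN.snr vx vw)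
    (x : Fin n → ℝ) (hx : x ∈ AWGN.constEnergy n vx)
    (lam lam' γ : ℝ)
    (hlam : 2 * lam = 1 + Real.log (1 + Ω) - Ω / (1 + Ω) * lam')
    (hγ : 0 < γ) (hlam' : lam' = Ω / (4 * Real.sinh γ ^ 2)) :
    -- the function `t` is well defined and differentiable away from `0`
    (∀ u : ℝ, u ≠ 0 → (∃! z : ℂ, AWGN.tInv γ z = (u : ℂ)) ∧
      AWGN.tInv γ (AWGN.tfun γ u) = (u : ℂ) ∧ DifferentiableAt ℝ (AWGN.tfun γ) u) ∧
    -- the two error probabilities are non-central chi-squared probabilities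
    AWGN.probMD vx vw x lam = AWGN.chiSqCCDF (n * lam') n (n / Ω) ∧
    AWGN.probFA vx vw x lam = AWGN.chiSqCDF (n * lam' / (1 + Ω)) n (n * ((1 + Ω) / Ω)) ∧
    -- missed detection
    (γ ≠ AWGN.thetaMD Ω γ →
      IntegrableOn (AWGN.gIntegrand n γ (AWGN.thetaMD Ω γ)) (Ioi 0) ∧
      AWGN.probMD vx vw x lam =
        AWGN.unitStep (AWGN.sgn γ (AWGN.thetaMD Ω γ)) +
          AWGN.gfun n γ (AWGN.thetaMD Ω γ) *
            Real.exp (-(1 / 2) * n * AWGN.vfun γ (AWGN.thetaMD Ω γ))) ∧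
    -- false alarm
    (γ ≠ AWGN.thetaFA Ω γ →
      IntegrableOn (AWGN.gIntegrand n γ (AWGN.thetaFA Ω γ)) (Ioi 0) ∧
      AWGN.probFA vx vw x lam =
        AWGN.unitStep (-AWGN.sgn γ (AWGN.thetaFA Ω γ)) -
          AWGN.gfun n γ (AWGN.thetaFA Ω γ) *
            Real.exp (-(1 / 2) * n * AWGN.vfun γ (AWGN.thetaFA Ω γ))) := by
  have hsγ : 0 < Real.sinh γ := Real.sinh_pos_iff.2 hγ
  have hΩ0 : 0 < Ω := by rw [hΩ]; exact div_pos hvx hvw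
  have hMD : AWGN.probMD vx vw x lam = AWGN.chiSqCCDF (n * lam') n (n / Ω) := by
    subst hΩ; exact AWGN.probMD_eq_chiSqCCDF hn hvx hvw hx hlam
  have hFA : AWGN.probFA vx vw x lam =
      AWGN.chiSqCDF (n * lam' / (1 + Ω)) n (n * ((1 + Ω) / Ω)) := by
    subst hΩ; exact AWGN.probFA_eq_chiSqCDF hn hvx hvw hx hlam
  have heMD : Real.exp (AWGN.thetaMD Ω γ) = Ω / (2 * Real.sinh γ) := by
    rw [AWGN.thetaMD, Real.exp_log (by positivity)]
  have heFA : Real.exp (AWGN.thetaFA Ω γ) = Ω / (2 * Real.sinh γ) / (1 + Ω) := by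
    rw [AWGN.thetaFA, Real.exp_sub, Real.exp_log (by positivity), Real.exp_log (by positivity)]
  refine ⟨fun u hu => ⟨AWGN.existsUnique_tInv_eq hγ hu, AWGN.tInv_tfun hγ hu,
    (AWGN.hasDerivAt_tfun hγ hu).differentiableAt⟩, hMD, hFA, fun hθ => ⟨?_, ?_⟩,
    fun hθ => ⟨?_, ?_⟩⟩
  · exact AWGN.integrableOn_gIntegrand hn hγ hθ
  · rw [hMD, ← AWGN.chiSqCCDF_eq hn hγ hθ, Real.exp_neg, heMD, hlam']
    congr 1
    · field_simp; ring
    · field_simp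
  · exact AWGN.integrableOn_gIntegrand hn hγ hθ
  · rw [hFA, ← AWGN.chiSqCDF_eq hn hγ hθ, Real.exp_neg, heFA, hlam']
    congr 1
    · field_simp; ring
    · field_simp
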